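/- **Exact implied volatility in the Vasicek model.** Let $\kappa,\delta>0$ and $\theta\in\mathbb R$. On a filtered probability space $(\Omega,\mathcal F,(\mathcal F_t)_{t\ge 0},\mathbb P)$, where $\mathbb P$ is the pricing measure, let $W$ be an $(\mathcal F_t)$-Brownian motion and let $Y$ be a continuous adapted solution of $$dY_t=\kappa(\theta-Y_t)\,dt+\delta\,dW_t .$$ The short rate is $R_t=Y_t$ and the money market account is $M_t=\exp\big(\int_0^tY_s\,ds\big)$; assume that $1/M_T$ is integrable for every $T\ge 0$ (automatic if $Y_0$ is deterministic). A claim $H$ paid at time $T$ is worth $M_t\,\mathbb E(H/M_T\mid\mathcal F_t)$ at time $t\le T$. Thus $B^T_t=M_t\,\mathbb E(1/M_T\mid\mathcal F_t)$ is the zero-coupon bond with maturity $T$. For $T<\bar T$ let $X_t=\log(B^{\bar T}_t/B^T_t)$, and let $V_t=M_t\,\mathbb E\big((B^{\bar T}_T-e^k)^+/M_T\mid\mathcal F_t\big)$ be the price of the call on $B^{\bar T}$ with maturity $T$ and log strike $k\in\mathbb R$. For $T\ge0$ let $F(\cdot\,;T),G(\cdot\,;T)$ solve on $[0,T]$ the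 equations $$\partial_tF=\tfrac12\delta^2G^2-\kappa\theta G,\qquad \partial_tG=\kappa G-1,\qquad F(T;T)=G(T;T)=0,$$ and let $c$ be the coefficient of the generator $c(t,x)(\partial_x^2-\partial_x)$ of $X$ under the $T$-forward measure, as given by the formula for one-factor affine models with factor volatility $\sigma(t,y)$ (here $\sigma\equiv\delta$): $$c(t,x)=\tfrac12\,\sigma(t,\eta(t,x))^2\,\big(G(t;T)-G(t;\bar T)\big)^2,\qquad \eta(t,x)=\frac{F(t;T)-F(t;\bar T)-x}{G(t;\bar T)-G(t;T)} .$$ 1. For $0\le t\le T<\bar T$ the coefficient does not depend on $x$: $$c(t,x)=\tfrac12\delta^2\Big(\frac{1-e^{-\kappa(T-t)}}{\kappa}-\frac{1-e^{-\kappa(\bar T-t)}}{\kappa}\Big)^2\qquad(x\in\mathbb R).$$ 2. For all $0\le T<\bar T$ and $k\in\mathbb R$ there is a continuous function $v(t,x)=v(t,x;T,\bar T,k)$ on $[0,T]\times\mathbb R$ with $V_t/B^T_t=v(t,X_t)$ a.s. for every $t\in[0,T]$. It is a classical solution on $(0,T)\times\mathbb R$ of $\partial_tv+c\,(\partial_x^2v-\partial_xv)=0$,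 with $v(T,x)=(e^x-e^k)^+$. 3. Let $0\le t<T<\bar T$ and $x,k\in\mathbb R$. The forward Black–Scholes call price with volatility $S>0$ is $$v^{BS}(S)=e^x\Phi(d_+)-e^k\Phi(d_-),\qquad d_\pm=\frac{1}{S\sqrt{T-t}}\Big(x-k\pm\frac{S^2(T-t)}{2}\Big),$$ where $\Phi$ is the standard normal distribution function. The equation $v^{BS}(\Sigma)=v(t,x;T,\bar T,k)$ has exactly one positive solution $\Sigma=\Sigma(t,x;T,\bar T,k)$, the implied volatility. For every curve $\bar z:\mathbb R\to\mathbb R$ it equals the zeroth order approximation $$\Sigma_0=\sqrt{\frac{1}{T-t}\int_t^T2\,c(s,\bar z(s))\,ds},$$ and $$\Sigma=\Sigma_0=\sqrt{\frac1{T-t}\int_t^T\delta^2\Big(\frac{1-e^{-\kappa(T-s)}}{\kappa}-\frac{1-e^{-\kappa(\bar T-s)}}{\kappa}\Big)^2ds}=\frac{\delta}{\kappa^{3/2}}\sqrt{\frac{e^{2\kappa T}-e^{2\kappa t}}{2(T-t)}}\,\big(e^{-\kappa T}-e^{-\kappa\bar T}\big).$$ 4. For fixed $x,k$ and the remaining parameters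 fixed (with $0\le t$, $0<T$, $t<T<\bar T$ for the parameters that occur), $$\lim_{t\uparrow T}\Sigma=\frac\delta\kappa\big(1-e^{-\kappa(\bar T-T)}\big),\qquad \lim_{T\uparrow\bar T}\Sigma=0,\qquad \lim_{\bar T\to\infty}\Sigma=\frac{\delta}{\kappa^{3/2}}\sqrt{\frac{1-e^{-2\kappa(T-t)}}{2(T-t)}},$$ and, jointly, $\displaystyle\lim_{t\uparrow T,\ \bar T\to\infty}\Sigma=\frac\delta\kappa$. -/

import Mathlib

open MeasureTheory ProbabilityTheory Filter Topology Set
open scoped NNReal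

noncomputable section

namespace BondOptions

/-- A one-factor affine short-rate model: the short rate is `r (Y_t)`, where the factor `Y` has
drift `μ t y` and volatility `σ t y`, with `r`, `μ` and `σ ^ 2` affine in `y`. -/
structure AffineModel where
  r : ℝ → ℝ
  μ : ℝ → ℝ → ℝ
  σ : ℝ → ℝ → ℝ
  q : ℝ
  ψ : ℝ
  b : ℝ → ℝ
  β : ℝ → ℝ
  ℓ : ℝ → ℝ
  lam : ℝ → ℝ
  r_eq : ∀ y, r y = q + ψ * y
  μ_eq : ∀ t y, μ t y = b t + β t * y
  σ_sq : ∀ t y, σ t y ^ 2 = ℓ t + lam t * y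

/-- The Vasicek model `dY = κ (θ - Y) dt + δ dW`, `R = Y`. -/
def vasicek (κ θ δ : ℝ) : AffineModel where
  r y := y
  μ _ y := κ * (θ - y)
  σ _ _ := δ
  q := 0
  ψ := 1
  b _ := κ * θ
  β _ := -κ
  ℓ _ := δ ^ 2
  lam _ := 0
  r_eq y := by ring
  μ_eq t y := by ring
  σ_sq t y := by ring

/-- `F = F(·; T, ν)` and `G = G(·; T, ν)` solve, on `[0, T]`, the Riccati system of the affine
model, with terminal values `0` and `-ν`. -/
structure IsRiccatiSolution (A : AffineModel) (T ν : ℝ) (F G : ℝ → ℝ) : Prop where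
  F_ode : ∀ t ∈ Icc 0 T,
    HasDerivWithinAt F (1 / 2 * A.ℓ t * G t ^ 2 - A.b t * G t - A.q) (Icc 0 T) t
  F_terminal : F T = 0
  G_ode : ∀ t ∈ Icc 0 T,
    HasDerivWithinAt G (1 / 2 * A.lam t * G t ^ 2 - A.β t * G t - A.ψ) (Icc 0 T) t
  G_terminal : G T = -ν

/-- The factor as a function of the log forward bond price `x` at time `t`. Here
`F T t` and `G T t` stand for `F(t; T, 0)` and `G(t; T, 0)`. -/
def eta (F G : ℝ → ℝ → ℝ) (T Tb t x : ℝ) : ℝ :=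
  (F T t - F Tb t - x) / (G Tb t - G T t)

/-- The coefficient `c(t, x)` of the generator of the log forward bond price under the `T`-forward
measure. -/
def genCoeff (A : AffineModel) (F G : ℝ → ℝ → ℝ) (T Tb t x : ℝ) : ℝ :=
  1 / 2 * A.σ t (eta F G T Tb t x) ^ 2 * (G T t - G Tb t) ^ 2

/-- The operator `c(t, ·) (∂ₓ² - ∂ₓ)`, for a coefficient `c = c(t, ·)`. -/
def generator (c : ℝ → ℝ) (f : ℝ → ℝ) (x : ℝ) : ℝ :=
  c x * (deriv (deriv f) x - deriv f x)

/-- Zeroth order implied volatility: freeze the coefficient `c(s, x)` along the curve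
`s ↦ z s` and average the resulting instantaneous variance `2 c(s, z s)` over `[t, T]`. -/
def zerothOrderVol (c : ℝ → ℝ → ℝ) (z : ℝ → ℝ) (t T : ℝ) : ℝ :=
  √((∫ s in t..T, 2 * c s (z s)) / (T - t))

/-- `W` is a Brownian motion relative to the filtration `𝓕`. -/
structure IsFiltrationBrownian {Ω : Type*} {mΩ : MeasurableSpace Ω} (P : Measure Ω)
    (𝓕 : Filtration ℝ≥0 mΩ) (W : ℝ≥0 → Ω → ℝ) : Prop where
  brownian : IsBrownianReal W P
  adapted : Adapted 𝓕 W
  indep : ∀ s t : ℝ≥0, s ≤ t →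
    Indep (MeasurableSpace.comap (fun ω => W t ω - W s ω) inferInstance) (𝓕 s) P

/-- `Y` is a strong solution of `dY = κ (θ - Y) dt + δ dW`. The volatility is constant, so the
stochastic integral of `δ` against `W` over `[0, t]` is `δ (W t - W 0)`. -/
structure IsVasicekProcess {Ω : Type*} {mΩ : MeasurableSpace Ω} (P : Measure Ω)
    (𝓕 : Filtration ℝ≥0 mΩ) (κ θ δ : ℝ) (W Y : ℝ≥0 → Ω → ℝ) : Prop where
  adapted : Adapted 𝓕 Y
  cont : ∀ᵐ ω ∂P, Continuous fun t => Y t ω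
  sde : ∀ᵐ ω ∂P, ∀ t : ℝ≥0,
    Y t ω = Y 0 ω + (∫ s in (0 : ℝ)..t, κ * (θ - Y s.toNNReal ω)) + δ * (W t ω - W 0 ω)

section Market

variable {Ω : Type*} {mΩ : MeasurableSpace Ω}

/-- Money market account, `dM = r(Y) M dt` with `M 0 = 1`. -/
def moneyMarket (A : AffineModel) (Y : ℝ≥0 → Ω → ℝ) (t : ℝ≥0) (ω : Ω) : ℝ :=
  Real.exp (∫ s in (0 : ℝ)..t, A.r (Y s.toNNReal ω))

/-- Time-`t` price of a claim that pays `H` at time `T`: the ratio of price and money market account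
is a martingale under the pricing measure `P`. -/
def claimPrice (P : Measure Ω) (𝓕 : Filtration ℝ≥0 mΩ) (A : AffineModel) (Y : ℝ≥0 → Ω → ℝ)
    (T : ℝ≥0) (H : Ω → ℝ) (t : ℝ≥0) (ω : Ω) : ℝ :=
  moneyMarket A Y t ω * (P[fun ω' => H ω' / moneyMarket A Y T ω' | 𝓕 t]) ω

/-- Time-`t` price of the zero-coupon bond that pays one unit at time `T`. -/
def bondPrice (P : Measure Ω) (𝓕 : Filtration ℝ≥0 mΩ) (A : AffineModel) (Y : ℝ≥0 → Ω → ℝ)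
    (T : ℝ≥0) (t : ℝ≥0) : Ω → ℝ :=
  claimPrice P 𝓕 A Y T (fun _ => 1) t

/-- Call payoff with log strike `k`, as a function of the log price `x`. -/
def callPayoff (k x : ℝ) : ℝ := max (Real.exp x - Real.exp k) 0

/-- Time-`t` price of the call with log strike `k` and maturity `T` on the bond with maturity
`Tb`. -/
def callPrice (P : Measure Ω) (𝓕 : Filtration ℝ≥0 mΩ) (A : AffineModel) (Y : ℝ≥0 → Ω → ℝ)
    (T Tb : ℝ≥0) (k : ℝ) (t : ℝ≥0) : Ω → ℝ :=
  claimPrice P 𝓕 A Y T (fun ω => callPayoff k (Real.log (bondPrice P 𝓕 A Y Tb T ω))) t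

/-- Log of the `T`-forward price of the bond with maturity `Tb`. -/
def logForward (P : Measure Ω) (𝓕 : Filtration ℝ≥0 mΩ) (A : AffineModel) (Y : ℝ≥0 → Ω → ℝ)
    (T Tb : ℝ≥0) (t : ℝ≥0) (ω : Ω) : ℝ :=
  Real.log (bondPrice P 𝓕 A Y Tb t ω / bondPrice P 𝓕 A Y T t ω)

/-- `v` is the `T`-forward call price as a function `v(t, x)` of time and log forward bond price.
The continuity selects one version: in a model where the law of the log forward price charges
every open set at each time in `(0, T]`, at most one continuous `v` on `[0, T] × ℝ` has this
property. -/
structure IsForwardCallPrice (P : Measure Ω) (𝓕 : Filtration ℝ≥0 mΩ) (A : AffineModel)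
    (Y : ℝ≥0 → Ω → ℝ) (T Tb : ℝ≥0) (k : ℝ) (v : ℝ → ℝ → ℝ) : Prop where
  cont : ContinuousOn (fun p : ℝ × ℝ => v p.1 p.2) (Icc 0 (T : ℝ) ×ˢ univ)
  eq : ∀ t : ℝ≥0, t ≤ T →
    (fun ω => callPrice P 𝓕 A Y T Tb k t ω / bondPrice P 𝓕 A Y T t ω)
      =ᵐ[P] fun ω => v t (logForward P 𝓕 A Y T Tb t ω)

end Market

/-- Standard normal distribution function. -/
def Phi (d : ℝ) : ℝ := ∫ y in Iic d, (√(2 * Real.pi))⁻¹ * Real.exp (-y ^ 2 / 2)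

/-- Forward Black-Scholes call price with time to maturity `τ`, log forward price `x`, log strike
`k` and volatility `S`. -/
def vBS (τ x k S : ℝ) : ℝ :=
  Real.exp x * Phi (1 / (S * √τ) * (x - k + S ^ 2 * τ / 2))
    - Real.exp k * Phi (1 / (S * √τ) * (x - k - S ^ 2 * τ / 2))

/-- `S` is the implied volatility of the forward call price `p`: the unique positive solution of
`vBS S = p`. -/
def IsImpliedVol (τ x k p S : ℝ) : Prop :=
  (0 < S ∧ vBS τ x k S = p) ∧ ∀ S' : ℝ, 0 < S' → vBS τ x k S' = p → S' = S

/-- `v` is a classical solution on `(0, T) × ℝ` of `∂ₜ v + c(t, x) (∂ₓ² - ∂ₓ) v = 0` with terminal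
value `φ` at time `T`. -/
def SolvesBackward (c : ℝ → ℝ → ℝ) (T : ℝ) (φ : ℝ → ℝ) (v : ℝ → ℝ → ℝ) : Prop :=
  (∀ x, v T x = φ x) ∧
  ∀ t ∈ Ioo 0 T, ContDiff ℝ 2 (v t) ∧ ∀ x,
    DifferentiableAt ℝ (fun s => v s x) t ∧
    deriv (fun s => v s x) t + generator (c t) (v t) x = 0

end BondOptions

end

/-!
In the Vasicek model the log forward price `X` of a bond has deterministic volatility
`δ (G(t; T) - G(t; Tb))`. Hence, under the `T`-forward measure and conditionally on the past up to
`t`, the variable `X_T` is normal with variance `w = ∫ 2 c(s) ds` over `[t, T]`, where `c` does not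
depend on `x`. The forward call price is therefore the Black–Scholes price with total variance `w`,
and its implied volatility is `√(w / (T - t))`, which is the zeroth order approximation.

The probabilistic part runs as follows. Solving the integral equation path by path
(`integral_ornsteinUhlenbeck`, `ae_vasicek_explicit`) expresses `∫ Y ds` over `[t, T]` and `Y_T`
through `Y_t` and Wiener integrals with smooth deterministic integrands. Such an integral is
defined by integration by parts, so no stochastic integration is needed. Being a limit of weighted
sums of increments, it has an explicit characteristic function on every event of the past, and two
of them form a Gaussian pair `(ξ, η)` independent of the past
(`IsFiltrationBrownian.isIndepGaussianPair`). One member `ξ` comes from the discount factor and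
plays the role of the change to the forward measure: weighting with `exp ξ` only shifts the mean of
`η` (`IsIndepGaussianPair.map_tilted`). This gives conditional expectations of discounted claims
(`IsIndepGaussianPair.condExp_eq`, `condExp_div_moneyMarket`), and from them bond and call prices
(`callPrice_div_bondPrice_ae_eq`).

The analytic part works with the total variance `w` in place of the volatility. Written as a
Gaussian expectation (`callValue`), the price is jointly continuous down to `w = 0`, where it is the
payoff; for `w > 0` it is the Black–Scholes formula (`callValue_eq_bsPrice`), which satisfies
`∂_w v = (∂_x² v - ∂_x v) / 2`. Since `dw/dt = -2 c`, the backward equation follows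
(`solvesBackward_callValue`). Strict monotonicity in `w` gives uniqueness of the implied volatility.
-/

noncomputable section

namespace BondOptions

/-! ### The Black–Scholes price as a function of total variance -/

section BlackScholes

/-- Standard normal density. -/
def normalDensity (y : ℝ) : ℝ := (√(2 * Real.pi))⁻¹ * Real.exp (-y ^ 2 / 2)

lemma normalDensity_pos (y : ℝ) : 0 < normalDensity y := by
  have := Real.pi_pos
  unfold normalDensity; positivity

lemma contDiff_normalDensity {n : WithTop ℕ∞} : ContDiff ℝ n normalDensity := by
  unfold normalDensity; fun_prop

lemma continuous_normalDensity : Continuous normalDensity :=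
  (contDiff_normalDensity (n := 0)).continuous

lemma gaussianPDFReal_zero_one : gaussianPDFReal 0 1 = normalDensity := by
  funext y; simp [gaussianPDFReal, normalDensity]

lemma integrable_normalDensity : Integrable normalDensity := by
  rw [← gaussianPDFReal_zero_one]; exact integrable_gaussianPDFReal 0 1

lemma integral_gaussianReal_zero_one (f : ℝ → ℝ) :
    ∫ z, f z ∂gaussianReal 0 1 = ∫ z, normalDensity z * f z := by
  rw [integral_gaussianReal_eq_integral_smul one_ne_zero, gaussianPDFReal_zero_one]
  rfl

lemma hasDerivAt_Phi (d : ℝ) : HasDerivAt Phi (normalDensity d) d := by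
  have h : Phi = fun d => Phi 0 + ∫ y in (0 : ℝ)..d, normalDensity y := by
    funext d
    rw [← intervalIntegral.integral_Iic_sub_Iic integrable_normalDensity.integrableOn
      integrable_normalDensity.integrableOn]
    simp [Phi, normalDensity]
  rw [h]
  exact (continuous_normalDensity.integral_hasStrictDerivAt 0 d).hasDerivAt.const_add _

lemma contDiff_Phi : ContDiff ℝ 2 Phi := by
  have h : deriv Phi = normalDensity := funext fun d => (hasDerivAt_Phi d).deriv
  rw [show (2 : WithTop ℕ∞) = 1 + 1 from rfl, contDiff_succ_iff_deriv, h]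
  exact ⟨fun d => (hasDerivAt_Phi d).differentiableAt, by simp, contDiff_normalDensity⟩

/-- Black–Scholes price of the call as a function of the total variance `w = S² (T - t)`. -/
def bsPrice (k w x : ℝ) : ℝ :=
  Real.exp x * Phi ((x - k + w / 2) / √w) - Real.exp k * Phi ((x - k - w / 2) / √w)

lemma vBS_eq_bsPrice (τ : ℝ) {S : ℝ} (hS : 0 < S) (x k : ℝ) :
    vBS τ x k S = bsPrice k (S ^ 2 * τ) x := by
  rw [vBS, bsPrice, Real.sqrt_mul (sq_nonneg S), Real.sqrt_sq hS.le]
  simp only [one_div_mul_eq_div]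

/-- The vega identity `exp x * φ(d₊) = exp k * φ(d₋)`. -/
lemma exp_mul_normalDensity_eq {w : ℝ} (hw : 0 < w) (k x : ℝ) :
    Real.exp k * normalDensity ((x - k - w / 2) / √w)
      = Real.exp x * normalDensity ((x - k + w / 2) / √w) := by
  have h : k + -((x - k - w / 2) / √w) ^ 2 / 2 = x + -((x - k + w / 2) / √w) ^ 2 / 2 := by
    rw [div_pow, div_pow, Real.sq_sqrt hw.le]; field_simp; ring
  simp only [normalDensity]
  rw [mul_left_comm, ← Real.exp_add, h, Real.exp_add, mul_left_comm]

lemma hasDerivAt_bsPrice {w : ℝ} (hw : 0 < w) (k x : ℝ) :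
    HasDerivAt (bsPrice k w) (Real.exp x * Phi ((x - k + w / 2) / √w)) x := by
  have h1 : HasDerivAt (fun x => (x - k + w / 2) / √w) (1 / √w) x :=
    (((hasDerivAt_id x).sub_const k).add_const (w / 2)).div_const _
  have h2 : HasDerivAt (fun x => (x - k - w / 2) / √w) (1 / √w) x :=
    (((hasDerivAt_id x).sub_const k).sub_const (w / 2)).div_const _
  have h := ((Real.hasDerivAt_exp x).mul ((hasDerivAt_Phi _).comp x h1)).sub
    (((hasDerivAt_Phi _).comp x h2).const_mul (Real.exp k))
  refine h.congr_deriv ?_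
  have := exp_mul_normalDensity_eq hw k x
  simp only [Function.comp]
  linear_combination (- (1 / √w)) * this

lemma hasDerivAt_deriv_bsPrice {w : ℝ} (hw : 0 < w) (k x : ℝ) :
    HasDerivAt (deriv (bsPrice k w)) (Real.exp x * Phi ((x - k + w / 2) / √w)
      + Real.exp x * normalDensity ((x - k + w / 2) / √w) / √w) x := by
  rw [show deriv (bsPrice k w) = fun x => Real.exp x * Phi ((x - k + w / 2) / √w) from
    funext fun x => (hasDerivAt_bsPrice hw k x).deriv]
  have h1 : HasDerivAt (fun x => (x - k + w / 2) / √w) (1 / √w) x :=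
    (((hasDerivAt_id x).sub_const k).add_const (w / 2)).div_const _
  refine ((Real.hasDerivAt_exp x).mul ((hasDerivAt_Phi _).comp x h1)).congr_deriv ?_
  simp only [Function.comp]
  ring

lemma hasDerivAt_bsPrice_variance {w : ℝ} (hw : 0 < w) (k x : ℝ) :
    HasDerivAt (fun w => bsPrice k w x)
      (Real.exp x * normalDensity ((x - k + w / 2) / √w) / (2 * √w)) w := by
  have hs := Real.hasDerivAt_sqrt hw.ne'
  have hsq : √w ≠ 0 := (Real.sqrt_pos.2 hw).ne'
  have h1 := (((hasDerivAt_id w).div_const 2).const_add (x - k)).div hs hsq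
  have h2 := (((hasDerivAt_id w).div_const 2).const_sub (x - k)).div hs hsq
  have h := (((hasDerivAt_Phi _).comp w h1).const_mul (Real.exp x)).sub
    (((hasDerivAt_Phi _).comp w h2).const_mul (Real.exp k))
  refine h.congr_deriv ?_
  have h3 := exp_mul_normalDensity_eq hw k x
  simp only [id, Pi.div_apply]
  rw [← mul_assoc, ← mul_assoc, h3, ← mul_sub, div_eq_mul_one_div (Real.exp x * _)]
  congr 1
  obtain ⟨s, hs0, rfl⟩ : ∃ s, 0 < s ∧ w = s ^ 2 :=
    ⟨√w, Real.sqrt_pos.2 hw, (Real.sq_sqrt hw.le).symm⟩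
  rw [Real.sqrt_sq hs0.le]
  field_simp
  ring

lemma contDiff_bsPrice (k w : ℝ) : ContDiff ℝ 2 (bsPrice k w) := by
  have h1 : ContDiff ℝ 2 fun x => Phi ((x - k + w / 2) / √w) := contDiff_Phi.comp (by fun_prop)
  have h2 : ContDiff ℝ 2 fun x => Phi ((x - k - w / 2) / √w) := contDiff_Phi.comp (by fun_prop)
  exact (Real.contDiff_exp.mul h1).sub (contDiff_const.mul h2)

/-- The price is strictly increasing in the total variance, so implied volatilities are unique. -/
lemma strictMonoOn_bsPrice (k x : ℝ) : StrictMonoOn (fun w => bsPrice k w x) (Ioi 0) := by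
  refine strictMonoOn_of_deriv_pos (convex_Ioi 0)
    (fun w hw => (hasDerivAt_bsPrice_variance hw k x).continuousAt.continuousWithinAt) fun w hw => ?_
  rw [interior_Ioi] at hw
  rw [(hasDerivAt_bsPrice_variance hw k x).deriv]
  have := Real.sqrt_pos.2 hw
  have := normalDensity_pos ((x - k + w / 2) / √w)
  positivity

lemma isImpliedVol_of_eq_bsPrice {τ S w : ℝ} (hτ : 0 < τ) (hS : 0 < S) (hw : S ^ 2 * τ = w)
    (x k : ℝ) : IsImpliedVol τ x k (bsPrice k w x) S := by
  refine ⟨⟨hS, by rw [vBS_eq_bsPrice τ hS, hw]⟩, fun S' hS' h => ?_⟩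
  rw [vBS_eq_bsPrice τ hS', ← hw] at h
  have h1 := (strictMonoOn_bsPrice k x).injOn (mem_Ioi.2 (by positivity : 0 < S' ^ 2 * τ))
    (mem_Ioi.2 (by positivity : 0 < S ^ 2 * τ)) h
  have h2 := mul_right_cancel₀ hτ.ne' h1
  exact (sq_eq_sq₀ hS'.le hS.le).1 h2

/-- Forward price of the call when the log forward price is lognormal with total variance `w`,
as an expectation. It makes sense for `w = 0` too, where it is the payoff. -/
def callValue (k w x : ℝ) : ℝ := ∫ z, callPayoff k (x - w / 2 + √w * z) ∂gaussianReal 0 1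

lemma callPayoff_nonneg (k x : ℝ) : 0 ≤ callPayoff k x := le_max_right _ _

lemma callPayoff_le_exp (k x : ℝ) : callPayoff k x ≤ Real.exp x :=
  max_le (by linarith [Real.exp_pos k]) (Real.exp_pos x).le

lemma continuous_callPayoff (k : ℝ) : Continuous (callPayoff k) := by
  unfold callPayoff; fun_prop

lemma callValue_zero (k x : ℝ) : callValue k 0 x = callPayoff k x := by simp [callValue]

lemma continuous_callValue (k : ℝ) : Continuous fun p : ℝ × ℝ => callValue k p.1 p.2 := by
  rw [continuous_iff_continuousAt]
  rintro ⟨w₀, x₀⟩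
  have hc := continuous_callPayoff k
  -- near `(w₀, x₀)` the exponent is at most `a + b |z|`
  set a := x₀ + 1 + (|w₀| + 1) / 2
  set b := √(|w₀| + 1)
  refine continuousAt_of_dominated
    (bound := fun z => Real.exp a * (Real.exp (b * z) + Real.exp (-b * z)))
    (Eventually.of_forall fun p => ?_) ?_ ?_ ?_
  · exact (hc.comp (by fun_prop)).aestronglyMeasurable
  · have h1 : ∀ᶠ p : ℝ × ℝ in 𝓝 (w₀, x₀), |p.1| < |w₀| + 1 :=
      (continuous_fst.abs.tendsto (w₀, x₀)).eventually_lt_const (by simp)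
    have h2 : ∀ᶠ p : ℝ × ℝ in 𝓝 (w₀, x₀), p.2 < x₀ + 1 :=
      (continuous_snd.tendsto (w₀, x₀)).eventually_lt_const (by simp)
    filter_upwards [h1, h2] with p hp1 hp2
    refine ae_of_all _ fun z => ?_
    rw [Real.norm_eq_abs, abs_of_nonneg (callPayoff_nonneg _ _)]
    refine (callPayoff_le_exp _ _).trans ?_
    have hsqrt : √p.1 ≤ b := Real.sqrt_le_sqrt ((le_abs_self _).trans hp1.le)
    have hz : √p.1 * z ≤ b * |z| :=
      (mul_le_mul_of_nonneg_left (le_abs_self z) (Real.sqrt_nonneg _)).trans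
        (mul_le_mul_of_nonneg_right hsqrt (abs_nonneg z))
    have hle : p.2 - p.1 / 2 + √p.1 * z ≤ a + b * |z| := by
      have := (abs_lt.1 hp1).1
      simp only [a]
      linarith
    refine (Real.exp_le_exp.2 hle).trans ?_
    rw [Real.exp_add]
    refine mul_le_mul_of_nonneg_left ?_ (Real.exp_pos a).le
    rcases abs_cases z with ⟨hz, -⟩ | ⟨hz, -⟩ <;> rw [hz]
    · linarith [Real.exp_pos (-b * z)]
    · rw [mul_neg, ← neg_mul]; linarith [Real.exp_pos (b * z)]
  · exact ((integrable_exp_mul_gaussianReal b).add (integrable_exp_mul_gaussianReal (-b))).const_mul _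
  · refine ae_of_all _ fun z => (hc.comp ?_).continuousAt
    fun_prop

lemma integral_Ici_normalDensity_mul_exp (a c : ℝ) :
    ∫ z in Ici c, normalDensity z * Real.exp (a * z) = Real.exp (a ^ 2 / 2) * Phi (a - c) := by
  rw [Phi, ← integral_indicator measurableSet_Ici, ← integral_indicator measurableSet_Iic,
    ← integral_const_mul, ← integral_sub_left_eq_self _ volume a]
  congr 1
  funext z
  by_cases hz : c ≤ a - z
  · rw [indicator_of_mem (mem_Ici.2 hz), indicator_of_mem (mem_Iic.2 (by linarith)),
      normalDensity, mul_assoc, ← Real.exp_add, mul_left_comm, ← Real.exp_add]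
    ring_nf
  · rw [indicator_of_notMem (by simpa using hz), indicator_of_notMem, mul_zero]
    simp only [mem_Iic, not_le]; linarith

lemma callValue_eq_bsPrice {w : ℝ} (hw : 0 < w) (k x : ℝ) : callValue k w x = bsPrice k w x := by
  have hs : 0 < √w := Real.sqrt_pos.2 hw
  -- the option is in the money exactly for `z ≥ c`
  set c := (k - x + w / 2) / √w with hc
  have hint : ∀ a, Integrable fun z => normalDensity z * Real.exp (a * z) := by
    intro a
    have h := integrable_exp_mul_gaussianReal (μ := 0) (v := 1) a
    rw [gaussianReal_of_var_ne_zero _ one_ne_zero, integrable_withDensity_iff_integrable_smul'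
      (by fun_prop) (ae_of_all _ fun z => by simp [gaussianPDF])] at h
    simpa only [toReal_gaussianPDF, gaussianPDFReal_zero_one, smul_eq_mul] using h
  have hpay : ∀ z, normalDensity z * callPayoff k (x - w / 2 + √w * z)
      = (Ici c).indicator (fun z => Real.exp (x - w / 2) * (normalDensity z * Real.exp (√w * z))
          - Real.exp k * (normalDensity z * Real.exp (0 * z))) z := by
    intro z
    have hiff : c ≤ z ↔ k ≤ x - w / 2 + √w * z := by
      rw [hc, div_le_iff₀ hs]
      constructor <;> intro h <;> linarith
    by_cases hz : c ≤ z
    · rw [indicator_of_mem (mem_Ici.2 hz), callPayoff,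
        max_eq_left (sub_nonneg.2 (Real.exp_le_exp.2 (hiff.1 hz))), Real.exp_add, zero_mul,
        Real.exp_zero]
      ring
    · rw [indicator_of_notMem (by simpa using hz), callPayoff, max_eq_right, mul_zero]
      rw [hiff, not_le] at hz
      exact sub_nonpos.2 (Real.exp_le_exp.2 hz.le)
  rw [callValue, integral_gaussianReal_zero_one]
  simp only [hpay]
  rw [integral_indicator measurableSet_Ici,
    integral_sub ((hint _).const_mul _).integrableOn ((hint _).const_mul _).integrableOn,
    integral_const_mul, integral_const_mul, integral_Ici_normalDensity_mul_exp,
    integral_Ici_normalDensity_mul_exp, Real.sq_sqrt hw.le, ← mul_assoc, ← Real.exp_add, bsPrice]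
  have e1 : √w - c = (x - k + w / 2) / √w := by
    rw [hc, eq_div_iff hs.ne', sub_mul, div_mul_cancel₀ _ hs.ne', Real.mul_self_sqrt hw.le]; ring
  have e2 : 0 - c = (x - k - w / 2) / √w := by rw [hc]; ring
  rw [e1, e2]
  norm_num

end BlackScholes

/-! ### Gaussian pairs independent of a σ-algebra -/

section ConditionallyGaussian

variable {Ω : Type*} {m mΩ : MeasurableSpace Ω} {P : Measure Ω} [IsProbabilityMeasure P]

/-- The pair `(ξ, η)` is centred Gaussian with covariance matrix `!![p, q; q, r]` and independent of
the σ-algebra `m`. Both properties are expressed at once by the characteristic function of the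
pair on each event of `m`. -/
structure IsIndepGaussianPair {Ω : Type*} {mΩ : MeasurableSpace Ω} (P : Measure Ω)
    (m : MeasurableSpace Ω) (ξ η : Ω → ℝ) (p q r : ℝ) : Prop where
  aemeasurable_fst : AEMeasurable ξ P
  aemeasurable_snd : AEMeasurable η P
  setIntegral_cexp : ∀ A, MeasurableSet[m] A → ∀ a b : ℝ,
    ∫ ω in A, Complex.exp ((a * ξ ω + b * η ω : ℝ) * Complex.I) ∂P
      = P.real A * Complex.exp ((-(a ^ 2 * p + 2 * a * b * q + b ^ 2 * r) / 2 : ℝ) : ℂ)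

variable {ξ η : Ω → ℝ} {p q r : ℝ}

lemma IsIndepGaussianPair.indepFun (hm : m ≤ mΩ) (h : IsIndepGaussianPair P m ξ η p q r) :
    @IndepFun Ω Ω (ℝ × ℝ) mΩ m inferInstance id (fun ω => (ξ ω, η ω)) P := by
  have hZ : AEMeasurable (fun ω => (ξ ω, η ω)) P := h.aemeasurable_fst.prodMk h.aemeasurable_snd
  have key : ∀ A, MeasurableSet[m] A →
      (P.restrict A).map (fun ω => (ξ ω, η ω)) = P A • P.map (fun ω => (ξ ω, η ω)) := by
    intro A hA
    have : IsFiniteMeasure (P A • P.map (fun ω => (ξ ω, η ω))) :=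
      Measure.smul_finite _ (measure_ne_top P A)
    refine Measure.ext_of_charFunDual (funext fun L => ?_)
    obtain ⟨a, b, hL⟩ : ∃ a b : ℝ, ∀ z : ℝ × ℝ, L z = a * z.1 + b * z.2 := by
      refine ⟨L (1, 0), L (0, 1), fun z => ?_⟩
      have : z = z.1 • ((1 : ℝ), (0 : ℝ)) + z.2 • ((0 : ℝ), (1 : ℝ)) := by ext <;> simp
      conv_lhs => rw [this, map_add, map_smul, map_smul]
      simp only [smul_eq_mul, mul_comm]
    rw [charFunDual_apply, charFunDual_apply, integral_smul_measure,
      integral_map hZ.restrict (by fun_prop), integral_map hZ (by fun_prop)]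
    simp only [hL]
    rw [h.setIntegral_cexp A hA, ← setIntegral_univ,
      h.setIntegral_cexp univ MeasurableSet.univ, Complex.real_smul, probReal_univ,
      Complex.ofReal_one, one_mul]
    rfl
  rw [indepFun_iff_measure_inter_preimage_eq_mul]
  intro A B hA hB
  have := congrArg (fun μ : Measure (ℝ × ℝ) => μ B) (key A hA)
  simp only [Measure.smul_apply, smul_eq_mul] at this
  rw [Measure.map_apply_of_aemeasurable hZ.restrict hB, Measure.map_apply_of_aemeasurable hZ hB,
    Measure.restrict_apply' (hm A hA)] at this
  rw [inter_comm]
  exact this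

lemma IsIndepGaussianPair.variance_nonneg (h : IsIndepGaussianPair P m ξ η p q r) (a b : ℝ) :
    0 ≤ a ^ 2 * p + 2 * a * b * q + b ^ 2 * r := by
  have h1 := h.setIntegral_cexp univ MeasurableSet.univ a b
  rw [setIntegral_univ, probReal_univ, Complex.ofReal_one, one_mul] at h1
  have h2 := norm_integral_le_of_norm_le_const (μ := P) (C := 1)
    (f := fun ω => Complex.exp ((a * ξ ω + b * η ω : ℝ) * Complex.I))
    (ae_of_all _ fun ω => (Complex.norm_exp_ofReal_mul_I _).le)
  rw [h1, Complex.norm_exp_ofReal, probReal_univ, mul_one, Real.exp_le_one_iff] at h2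
  linarith

lemma IsIndepGaussianPair.map_eq_gaussianReal (h : IsIndepGaussianPair P m ξ η p q r) (a b : ℝ) :
    P.map (fun ω => a * ξ ω + b * η ω)
      = gaussianReal 0 (a ^ 2 * p + 2 * a * b * q + b ^ 2 * r).toNNReal := by
  have hξ := h.aemeasurable_fst
  have hη := h.aemeasurable_snd
  have : AEMeasurable (fun ω => a * ξ ω + b * η ω) P := by fun_prop
  refine Measure.ext_of_charFun (funext fun t => ?_)
  rw [charFun_gaussianReal, charFun_apply_real, integral_map this (by fun_prop),
    ← setIntegral_univ]
  have h1 := h.setIntegral_cexp univ MeasurableSet.univ (t * a) (t * b)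
  rw [probReal_univ, Complex.ofReal_one, one_mul] at h1
  convert h1 using 3
  · push_cast; ring_nf
  · rw [Real.coe_toNNReal _ (h.variance_nonneg a b)]
    push_cast; ring

lemma IsIndepGaussianPair.integrable_exp (h : IsIndepGaussianPair P m ξ η p q r) (a b : ℝ) :
    Integrable (fun ω => Real.exp (a * ξ ω + b * η ω)) P ∧
    ∫ ω, Real.exp (a * ξ ω + b * η ω) ∂P
      = Real.exp ((a ^ 2 * p + 2 * a * b * q + b ^ 2 * r) / 2) := by
  have h1 := mgf_gaussianReal (h.map_eq_gaussianReal a b) 1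
  have h2 : 0 < mgf (fun ω => a * ξ ω + b * η ω) P 1 := by rw [h1]; positivity
  rw [mgf_pos_iff] at h2
  refine ⟨by simpa using h2, ?_⟩
  rw [mgf, Real.coe_toNNReal _ (h.variance_nonneg a b)] at h1
  simpa using h1

/-- Cameron–Martin in dimension one: under the measure with density proportional to `exp ξ`, the
variable `η` keeps its variance and its mean is shifted by its covariance with `ξ`. -/
lemma IsIndepGaussianPair.map_tilted (h : IsIndepGaussianPair P m ξ η p q r) :
    (P.tilted ξ).map η = gaussianReal q r.toNNReal := by
  have hr : 0 ≤ r := by simpa using h.variance_nonneg 0 1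
  have hint : Integrable (fun ω => Real.exp (ξ ω)) P := by
    simpa using (h.integrable_exp 1 0).1
  have hZ : ∫ ω, Real.exp (ξ ω) ∂P = Real.exp (p / 2) := by
    simpa using (h.integrable_exp 1 0).2
  have : IsProbabilityMeasure (P.tilted ξ) := isProbabilityMeasure_tilted hint
  have hη : AEMeasurable η (P.tilted ξ) :=
    h.aemeasurable_snd.mono_ac (tilted_absolutelyContinuous _ _)
  have hmgf : mgf η (P.tilted ξ) = mgf id (gaussianReal q r.toNNReal) := by
    rw [mgf_id_gaussianReal]
    funext s
    have h1 := (h.integrable_exp 1 s).2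
    rw [mgf, integral_tilted, hZ, Real.coe_toNNReal _ hr]
    simp only [smul_eq_mul, div_eq_mul_inv, ← Real.exp_neg]
    rw [integral_congr_ae (g := fun ω => Real.exp (-(p * 2⁻¹)) * Real.exp (1 * ξ ω + s * η ω))
      (ae_of_all _ fun ω => by simp only [← Real.exp_add]; ring_nf), integral_const_mul, h1,
      ← Real.exp_add]
    ring_nf
  have hset : integrableExpSet η (P.tilted ξ) = univ := by
    rw [integrableExpSet_eq_of_mgf hmgf]
    exact integrableExpSet_id_gaussianReal
  have := Measure.ext_of_complexMGF_eq hη aemeasurable_id (μ' := gaussianReal q r.toNNReal)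
    (funext fun z => eqOn_complexMGF_of_mgf hmgf (by simp [hset]))
  rwa [Measure.map_id] at this

lemma IsIndepGaussianPair.integral_exp_mul_comp (h : IsIndepGaussianPair P m ξ η p q r)
    {f : ℝ → ℝ} (hf : Measurable f) :
    ∫ ω, Real.exp (ξ ω) * f (η ω) ∂P
      = Real.exp (p / 2) * ∫ z, f (q + √r * z) ∂gaussianReal 0 1 := by
  have hr : 0 ≤ r := by simpa using h.variance_nonneg 0 1
  have hZ : ∫ ω, Real.exp (ξ ω) ∂P = Real.exp (p / 2) := by
    simpa using (h.integrable_exp 1 0).2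
  have hη : AEMeasurable η (P.tilted ξ) :=
    h.aemeasurable_snd.mono_ac (tilted_absolutelyContinuous _ _)
  have hg : gaussianReal q r.toNNReal = (gaussianReal 0 1).map (fun z => q + √r * z) := by
    have : (fun z => q + √r * z) = (fun z => q + z) ∘ (fun z => √r * z) := rfl
    rw [this, ← Measure.map_map (by fun_prop) (by fun_prop), gaussianReal_map_const_mul,
      gaussianReal_map_const_add]
    congr 1
    · simp
    · ext; simp [hr]
  have h1 : ∫ ω, f (η ω) ∂(P.tilted ξ) = ∫ z, f (q + √r * z) ∂gaussianReal 0 1 := by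
    rw [← integral_map hη hf.aestronglyMeasurable, h.map_tilted, hg,
      integral_map (by fun_prop) hf.aestronglyMeasurable]
  rw [← h1, integral_tilted, hZ, ← integral_const_mul]
  refine integral_congr_ae (ae_of_all _ fun ω => ?_)
  have := Real.exp_pos (p / 2)
  simp only [smul_eq_mul]
  field_simp

/-- Conditional expectation of a function of `X` and of a variable `Z` independent of `X`: freeze
`X` and integrate with respect to the law of `Z`. -/
lemma condExp_prod_ae_eq_integral_map_of_indepFun {α β E : Type*} {mα : MeasurableSpace α}
    {mβ : MeasurableSpace β} {mE : MeasurableSpace E} [StandardBorelSpace E] [Nonempty E]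
    {μ : Measure α} [IsProbabilityMeasure μ] {X : α → β} {Z : α → E} (hX : Measurable X)
    (hZ : AEMeasurable Z μ) (hXZ : IndepFun X Z μ) {f : β × E → ℝ} (hf : Measurable f)
    (hint : Integrable (fun a => f (X a, Z a)) μ) :
    μ[fun a => f (X a, Z a) | mβ.comap X] =ᵐ[μ] fun a => ∫ a', f (X a, Z a') ∂μ := by
  have hP : IsProbabilityMeasure (μ.map Z) := Measure.isProbabilityMeasure_map hZ
  have hprod := (indepFun_iff_map_prod_eq_prod_map_map hX.aemeasurable hZ).1 hXZ
  have hcd := condDistrib_ae_eq_of_measure_eq_compProd (κ := Kernel.const β (μ.map Z)) X hZ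
    (by rw [hprod, Measure.compProd_const])
  refine (condExp_prod_ae_eq_integral_condDistrib hX hZ hf.stronglyMeasurable hint).trans ?_
  filter_upwards [ae_of_ae_map hX.aemeasurable hcd] with a ha
  rw [ha, Kernel.const_apply, integral_map hZ]
  exact (hf.comp measurable_prodMk_left).aestronglyMeasurable

/-- Conditional expectation of a function of an `m`-measurable part and of an independent Gaussian
pair. -/
theorem IsIndepGaussianPair.condExp_eq (hm : m ≤ mΩ) (h : IsIndepGaussianPair P m ξ η p q r)
    {K X : Ω → ℝ} (hK : Measurable[m] K) (hX : Measurable[m] X) {f : ℝ → ℝ} (hf : Measurable f)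
    (hint : Integrable (fun ω => K ω * (Real.exp (ξ ω) * f (X ω + η ω))) P) :
    P[fun ω => K ω * (Real.exp (ξ ω) * f (X ω + η ω)) | m] =ᵐ[P]
      fun ω => K ω * (Real.exp (p / 2) * ∫ z, f (X ω + q + √r * z) ∂gaussianReal 0 1) := by
  have hZ : AEMeasurable (fun ω => (ξ ω, η ω)) P := h.aemeasurable_fst.prodMk h.aemeasurable_snd
  have hid : @Measurable Ω (ℝ × ℝ) mΩ inferInstance (fun ω => (K ω, X ω)) :=
    (hK.mono hm le_rfl).prodMk (hX.mono hm le_rfl)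
  have hF : @Measurable (Ω × (ℝ × ℝ)) ℝ (m.prod inferInstance) _
      (fun z : Ω × (ℝ × ℝ) => K z.1 * (Real.exp z.2.1 * f (X z.1 + z.2.2))) := by
    have h1 : @Measurable (Ω × (ℝ × ℝ)) ℝ (m.prod inferInstance) _ (fun z => K z.1) :=
      hK.comp (@measurable_fst Ω (ℝ × ℝ) m _)
    have h2 : @Measurable (Ω × (ℝ × ℝ)) ℝ (m.prod inferInstance) _ (fun z => X z.1) :=
      hX.comp (@measurable_fst Ω (ℝ × ℝ) m _)
    have h3 : @Measurable (Ω × (ℝ × ℝ)) (ℝ × ℝ) (m.prod inferInstance) _ (fun z => z.2) :=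
      @measurable_snd Ω (ℝ × ℝ) m _
    exact h1.mul ((Real.measurable_exp.comp h3.fst).mul (hf.comp (h2.add h3.snd)))
  have hce := @condExp_prod_ae_eq_integral_map_of_indepFun Ω Ω (ℝ × ℝ) mΩ m _ _ _ P _ id
    (fun ω => (ξ ω, η ω)) (measurable_id'' hm) hZ (h.indepFun hm) _ hF hint
  rw [MeasurableSpace.comap_id] at hce
  refine hce.trans (ae_of_all _ fun ω => ?_)
  have := h.integral_exp_mul_comp (f := fun y => f (X ω + y)) (by fun_prop)
  simp only [id]
  rw [integral_const_mul, this]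
  simp only [add_assoc]

end ConditionallyGaussian

/-! ### Wiener integrals of deterministic integrands -/

section WienerIntegral

/-- Summation by parts. -/
lemma sum_range_mul_sub_eq (a w : ℕ → ℝ) (n : ℕ) :
    ∑ i ∈ Finset.range n, a i * (w (i + 1) - w i)
      = a n * (w n - w 0)
        - ∑ i ∈ Finset.range n, (w (i + 1) - w 0) * (a (i + 1) - a i) := by
  induction n with
  | zero => simp
  | succ n ih => rw [Finset.sum_range_succ, Finset.sum_range_succ, ih]; ring

/-- The `i`-th point of the partition of `[a, b]` into `n` intervals of equal length. -/
def gridPoint (a b : ℝ) (n i : ℕ) : ℝ := a + i * ((b - a) / n)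

lemma gridPoint_zero (a b : ℝ) (n : ℕ) : gridPoint a b n 0 = a := by simp [gridPoint]

lemma gridPoint_self (a b : ℝ) {n : ℕ} (hn : n ≠ 0) : gridPoint a b n n = b := by
  have : (n : ℝ) ≠ 0 := by exact_mod_cast hn
  unfold gridPoint; field_simp; ring

lemma gridPoint_succ_sub (a b : ℝ) (n i : ℕ) :
    gridPoint a b n (i + 1) - gridPoint a b n i = (b - a) / n := by
  simp only [gridPoint]; push_cast; ring

lemma gridPoint_mono {a b : ℝ} (hab : a ≤ b) (n : ℕ) : Monotone (gridPoint a b n) := by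
  refine monotone_nat_of_le_succ fun i => ?_
  have := gridPoint_succ_sub a b n i
  have : 0 ≤ (b - a) / n := div_nonneg (by linarith) (by positivity)
  linarith

/-- Convergence of Riemann–Stieltjes sums, for the integrator `g x dx`. -/
lemma tendsto_sum_gridPoint {a b : ℝ} (hab : a ≤ b) {φ g : ℝ → ℝ} (hφ : Continuous φ)
    (hg : Continuous g) {x : ℕ → ℕ → ℝ}
    (hx : ∀ n i, x n i ∈ Icc (gridPoint a b n i) (gridPoint a b n (i + 1))) :
    Tendsto (fun n => ∑ i ∈ Finset.range n,
      φ (x n i) * ∫ s in gridPoint a b n i..gridPoint a b n (i + 1), g s) atTop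
      (𝓝 (∫ s in a..b, φ s * g s)) := by
  have hC : 0 ≤ ∫ s in a..b, |g s| :=
    intervalIntegral.integral_nonneg hab fun _ _ => abs_nonneg _
  set C := ∫ s in a..b, |g s| with hCdef
  rw [Metric.tendsto_atTop]
  intro ε hε
  have huc : UniformContinuousOn φ (Icc a b) :=
    isCompact_Icc.uniformContinuousOn_of_continuous hφ.continuousOn
  rw [Metric.uniformContinuousOn_iff] at huc
  obtain ⟨d, hd, hφd⟩ := huc (ε / (C + 1)) (by positivity)
  obtain ⟨N, hN⟩ := exists_nat_gt ((b - a) / d)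
  refine ⟨N + 1, fun n hn => ?_⟩
  have hn0 : n ≠ 0 := by omega
  have hnpos : (0 : ℝ) < n := by exact_mod_cast Nat.pos_of_ne_zero hn0
  have hmesh : (b - a) / n < d := by
    rw [div_lt_iff₀ hd] at hN
    rw [div_lt_iff₀ hnpos]
    have : (N : ℝ) ≤ n := by exact_mod_cast (by omega : N ≤ n)
    nlinarith
  have hmono := gridPoint_mono hab n
  have hsplit : ∀ h : ℝ → ℝ, Continuous h → ∫ s in a..b, h s
      = ∑ i ∈ Finset.range n, ∫ s in gridPoint a b n i..gridPoint a b n (i + 1), h s := by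
    intro h hh
    rw [intervalIntegral.sum_integral_adjacent_intervals
      (fun k _ => hh.intervalIntegrable _ _), gridPoint_zero, gridPoint_self a b hn0]
  rw [Real.dist_eq, hsplit (fun s => φ s * g s) (hφ.mul hg), ← Finset.sum_sub_distrib]
  calc |∑ i ∈ Finset.range n, (φ (x n i) * (∫ s in gridPoint a b n i..gridPoint a b n (i + 1), g s)
          - ∫ s in gridPoint a b n i..gridPoint a b n (i + 1), φ s * g s)|
      ≤ ∑ i ∈ Finset.range n, ε / (C + 1)
          * ∫ s in gridPoint a b n i..gridPoint a b n (i + 1), |g s| := by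
        refine (Finset.abs_sum_le_sum_abs _ _).trans (Finset.sum_le_sum fun i hi => ?_)
        have hle : gridPoint a b n i ≤ gridPoint a b n (i + 1) := hmono (Nat.le_succ i)
        have h0 : a ≤ gridPoint a b n i :=
          (gridPoint_zero a b n).ge.trans (hmono (Nat.zero_le i))
        have h1 : gridPoint a b n (i + 1) ≤ b :=
          (hmono (Nat.succ_le_of_lt (Finset.mem_range.1 hi))).trans (gridPoint_self a b hn0).le
        rw [← intervalIntegral.integral_const_mul, ← intervalIntegral.integral_sub
          (Continuous.intervalIntegrable (by fun_prop) _ _)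
          (Continuous.intervalIntegrable (by fun_prop) _ _),
          ← intervalIntegral.integral_const_mul, ← Real.norm_eq_abs]
        refine intervalIntegral.norm_integral_le_of_norm_le hle
          (ae_of_all _ fun s hs => ?_) ((hg.abs.const_mul _).intervalIntegrable _ _)
        rw [← sub_mul, Real.norm_eq_abs, abs_mul]
        refine mul_le_mul_of_nonneg_right ?_ (abs_nonneg _)
        have hxi := hx n i
        have hsub := gridPoint_succ_sub a b n i
        have := hφd (x n i) ⟨h0.trans hxi.1, hxi.2.trans h1⟩ s
          ⟨h0.trans hs.1.le, hs.2.trans h1⟩ (by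
            rw [Real.dist_eq, abs_lt]
            constructor <;> linarith [hs.1, hs.2, hxi.1, hxi.2])
        rw [Real.dist_eq] at this
        exact this.le
    _ = ε / (C + 1) * C := by rw [← Finset.mul_sum, ← hsplit _ hg.abs]
    _ < ε := by
        rw [div_mul_eq_mul_div, div_lt_iff₀ (by positivity)]
        nlinarith

variable {Ω : Type*} {mΩ : MeasurableSpace Ω} {P : Measure Ω} {𝓕 : Filtration ℝ≥0 mΩ}
  {W : ℝ≥0 → Ω → ℝ}

/-- The Wiener integral `∫ f dW` over `[t, T]` of a continuously differentiable deterministic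
integrand, defined path by path through integration by parts. -/
def wienerIntegral (W : ℝ≥0 → Ω → ℝ) (t T : ℝ≥0) (f : ℝ → ℝ) (ω : Ω) : ℝ :=
  f T * (W T ω - W t ω) - ∫ s in (t : ℝ)..T, (W s.toNNReal ω - W t ω) * deriv f s

lemma wienerIntegral_linear (t T : ℝ≥0) {f g : ℝ → ℝ} (hf : ContDiff ℝ 1 f)
    (hg : ContDiff ℝ 1 g) (a b : ℝ) {ω : Ω} (hω : Continuous fun s => W s ω) :
    wienerIntegral W t T (fun s => a * f s + b * g s) ω
      = a * wienerIntegral W t T f ω + b * wienerIntegral W t T g ω := by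
  have hw : Continuous fun s : ℝ => W s.toNNReal ω - W t ω :=
    (hω.comp continuous_real_toNNReal).sub continuous_const
  have hd : ∀ s, deriv (fun s => a * f s + b * g s) s = a * deriv f s + b * deriv g s := by
    intro s
    exact (((hf.differentiable one_ne_zero s).hasDerivAt.const_mul a).add
      ((hg.differentiable one_ne_zero s).hasDerivAt.const_mul b)).deriv
  have hf' := hf.continuous_deriv le_rfl
  have hg' := hg.continuous_deriv le_rfl
  have : ∫ s in (t : ℝ)..T, (W s.toNNReal ω - W t ω) * deriv (fun s => a * f s + b * g s) s
      = a * (∫ s in (t : ℝ)..T, (W s.toNNReal ω - W t ω) * deriv f s)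
        + b * ∫ s in (t : ℝ)..T, (W s.toNNReal ω - W t ω) * deriv g s := by
    rw [← intervalIntegral.integral_const_mul, ← intervalIntegral.integral_const_mul,
      ← intervalIntegral.integral_add (Continuous.intervalIntegrable (by fun_prop) _ _)
        (Continuous.intervalIntegrable (by fun_prop) _ _)]
    refine intervalIntegral.integral_congr fun s _ => ?_
    simp only [hd]; ring
  simp only [wienerIntegral, this]
  ring

/-- Riemann sums of the Wiener integral. -/
def wienerSum (W : ℝ≥0 → Ω → ℝ) (t T : ℝ≥0) (f : ℝ → ℝ) (n : ℕ) (ω : Ω) : ℝ :=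
  ∑ i ∈ Finset.range n, f (gridPoint t T n i)
    * (W (gridPoint t T n (i + 1)).toNNReal ω - W (gridPoint t T n i).toNNReal ω)

lemma tendsto_wienerSum {t T : ℝ≥0} (htT : t ≤ T) {f : ℝ → ℝ} (hf : ContDiff ℝ 1 f) {ω : Ω}
    (hω : Continuous fun s => W s ω) :
    Tendsto (fun n => wienerSum W t T f n ω) atTop (𝓝 (wienerIntegral W t T f ω)) := by
  have hle : (t : ℝ) ≤ T := htT
  have hw : Continuous fun s : ℝ => W s.toNNReal ω - W t ω :=
    (hω.comp continuous_real_toNNReal).sub continuous_const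
  have hf' := hf.continuous_deriv le_rfl
  have h := tendsto_sum_gridPoint hle hw hf' (x := fun n i => gridPoint t T n (i + 1))
    fun n i => ⟨gridPoint_mono hle n (Nat.le_succ i), le_rfl⟩
  refine (h.const_sub (f T * (W T ω - W t ω))).congr' ?_
  filter_upwards [eventually_ne_atTop 0] with n hn
  have hint : ∀ i, ∫ s in gridPoint t T n i..gridPoint t T n (i + 1), deriv f s
      = f (gridPoint t T n (i + 1)) - f (gridPoint t T n i) := fun i =>
    intervalIntegral.integral_deriv_eq_sub (fun x _ => hf.differentiable one_ne_zero x)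
      (hf'.intervalIntegrable _ _)
  rw [wienerSum, sum_range_mul_sub_eq (fun i => f (gridPoint t T n i))
    (fun i => W (gridPoint t T n i).toNNReal ω)]
  simp only [hint, gridPoint_zero, gridPoint_self _ _ hn, Real.toNNReal_coe]

lemma IsFiltrationBrownian.measurable (hW : IsFiltrationBrownian P 𝓕 W) {s t : ℝ≥0}
    (hst : s ≤ t) : Measurable[𝓕 t] (W s) :=
  (hW.adapted s).mono (𝓕.mono hst) le_rfl

lemma IsFiltrationBrownian.aemeasurable_wienerIntegral [IsProbabilityMeasure P]
    (hW : IsFiltrationBrownian P 𝓕 W)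
    {t T : ℝ≥0} (htT : t ≤ T) {f : ℝ → ℝ} (hf : ContDiff ℝ 1 f) :
    AEMeasurable (wienerIntegral W t T f) P := by
  have hm : ∀ s, Measurable (W s) := fun s => (hW.measurable le_rfl).mono (𝓕.le s) le_rfl
  refine aemeasurable_of_tendsto_metrizable_ae atTop (f := fun n => wienerSum W t T f n)
    (fun n => ?_) ?_
  · refine Measurable.aemeasurable ?_
    unfold wienerSum
    fun_prop
  · filter_upwards [hW.brownian.cont] with ω hω using tendsto_wienerSum htT hf hω

lemma IsFiltrationBrownian.integral_cexp_sub [IsProbabilityMeasure P]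
    (hW : IsFiltrationBrownian P 𝓕 W) {s t : ℝ≥0} (hst : s ≤ t) (c : ℝ) :
    ∫ ω, Complex.exp ((c * (W t ω - W s ω) : ℝ) * Complex.I) ∂P
      = Complex.exp ((-(c ^ 2 * (t - s)) / 2 : ℝ) : ℂ) := by
  have hlaw := hW.brownian.hasLaw_sub t s
  have h := charFun_gaussianReal (μ := 0) (v := nndist t.1 s.1) c
  rw [← hlaw.map_eq, charFun_apply_real, integral_map hlaw.aemeasurable (by fun_prop)] at h
  have hst' : (s : ℝ) ≤ t := hst
  have hd : ((nndist t.1 s.1 : ℝ≥0) : ℝ) = t - s := by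
    exact (coe_nndist _ _).trans ((Real.dist_eq _ _).trans (abs_of_nonneg (sub_nonneg.2 hst')))
  convert h using 3
  · simp
  · rw [hd]; push_cast; ring

/-- Characteristic function of a weighted sum of Brownian increments, on an event that is known at
the start. -/
lemma IsFiltrationBrownian.setIntegral_cexp_sum [IsProbabilityMeasure P]
    (hW : IsFiltrationBrownian P 𝓕 W) {u : ℕ → ℝ≥0} (hu : Monotone u) (c : ℕ → ℝ) {A : Set Ω}
    (hA : MeasurableSet[𝓕 (u 0)] A) (n : ℕ) :
    ∫ ω in A, Complex.exp
        ((∑ i ∈ Finset.range n, c i * (W (u (i + 1)) ω - W (u i) ω) : ℝ) * Complex.I) ∂P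
      = P.real A * Complex.exp
        ((-(∑ i ∈ Finset.range n, c i ^ 2 * (u (i + 1) - u i)) / 2 : ℝ) : ℂ) := by
  have hA' : MeasurableSet A := 𝓕.le _ _ hA
  induction n with
  | zero => simp
  | succ n ih =>
    rw [← integral_indicator hA'] at ih ⊢
    set Z : Ω → ℂ := A.indicator fun ω => Complex.exp
      ((∑ i ∈ Finset.range n, c i * (W (u (i + 1)) ω - W (u i) ω) : ℝ) * Complex.I) with hZ
    have hZm : Measurable[𝓕 (u n)] Z := by
      refine Measurable.indicator ?_ (𝓕.mono (hu (Nat.zero_le n)) _ hA)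
      refine Complex.measurable_exp.comp (Measurable.mul_const ?_ _)
      refine Complex.measurable_ofReal.comp (Finset.measurable_sum _ fun i hi => ?_)
      have hi' := Finset.mem_range.1 hi
      exact ((hW.measurable (hu hi')).sub (hW.measurable (hu hi'.le))).const_mul _
    have hind : IndepFun Z (fun ω => W (u (n + 1)) ω - W (u n) ω) P :=
      (indep_of_indep_of_le_right (hW.indep (u n) (u (n + 1)) (hu (Nat.le_succ n)))
        hZm.comap_le).symm
    have hm : ∀ s, Measurable (W s) := fun s => (hW.measurable le_rfl).mono (𝓕.le s) le_rfl
    have hmul := hind.integral_fun_comp_mul_comp (f := fun z => z)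
      (g := fun y : ℝ => Complex.exp ((c n * y : ℝ) * Complex.I))
      (hZm.mono (𝓕.le _) le_rfl).aemeasurable (by fun_prop) (by fun_prop) (by fun_prop)
    rw [ih, hW.integral_cexp_sub (hu (Nat.le_succ n)), mul_assoc, ← Complex.exp_add] at hmul
    refine (integral_congr_ae (ae_of_all _ fun ω => ?_)).trans (hmul.trans ?_)
    · by_cases hω : ω ∈ A
      · simp only [hZ, indicator_of_mem hω, ← Complex.exp_add, Finset.sum_range_succ]
        push_cast; ring_nf
      · simp [hZ, hω]
    · rw [Finset.sum_range_succ, Nat.succ_eq_add_one, ← Complex.ofReal_add]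
      congr 3
      ring

lemma IsFiltrationBrownian.setIntegral_cexp_wienerIntegral [IsProbabilityMeasure P]
    (hW : IsFiltrationBrownian P 𝓕 W) {t T : ℝ≥0} (htT : t ≤ T) {f : ℝ → ℝ}
    (hf : ContDiff ℝ 1 f) {A : Set Ω} (hA : MeasurableSet[𝓕 t] A) :
    ∫ ω in A, Complex.exp ((wienerIntegral W t T f ω : ℝ) * Complex.I) ∂P
      = P.real A * Complex.exp ((-(∫ s in (t : ℝ)..T, f s ^ 2) / 2 : ℝ) : ℂ) := by
  have hle : (t : ℝ) ≤ T := htT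
  have hm : ∀ s, Measurable (W s) := fun s => (hW.measurable le_rfl).mono (𝓕.le s) le_rfl
  have hsum : ∀ n, ∫ ω in A, Complex.exp ((wienerSum W t T f n ω : ℝ) * Complex.I) ∂P
      = P.real A * Complex.exp ((-(∑ i ∈ Finset.range n, f (gridPoint t T n i) ^ 2
        * ∫ s in gridPoint t T n i..gridPoint t T n (i + 1), (1 : ℝ)) / 2 : ℝ) : ℂ) := by
    intro n
    have hmono := gridPoint_mono hle n
    have h := hW.setIntegral_cexp_sum (u := fun i => (gridPoint t T n i).toNNReal)
      (fun i j hij => Real.toNNReal_le_toNNReal (hmono hij))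
      (fun i => f (gridPoint t T n i)) (A := A)
      (by rw [gridPoint_zero, Real.toNNReal_coe]; exact hA) n
    have hnn : ∀ i, 0 ≤ gridPoint t T n i := fun i =>
      t.2.trans ((gridPoint_zero (t : ℝ) T n).symm.le.trans (hmono (Nat.zero_le i)))
    simp only [Real.coe_toNNReal _ (hnn _)] at h
    simp only [wienerSum, h, integral_one]
  have hlim1 : Tendsto (fun n => ∫ ω in A, Complex.exp ((wienerSum W t T f n ω : ℝ) * Complex.I) ∂P)
      atTop (𝓝 (∫ ω in A, Complex.exp ((wienerIntegral W t T f ω : ℝ) * Complex.I) ∂P)) := by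
    refine tendsto_integral_of_dominated_convergence (fun _ => 1) (fun n => ?_)
      (integrable_const _) (fun n => ae_of_all _ fun ω => (Complex.norm_exp_ofReal_mul_I _).le) ?_
    · refine Measurable.aestronglyMeasurable ?_
      unfold wienerSum
      fun_prop
    · filter_upwards [ae_restrict_of_ae hW.brownian.cont] with ω hω
      have := tendsto_wienerSum htT hf hω
      exact (Complex.continuous_exp.comp
        (Complex.continuous_ofReal.mul continuous_const)).continuousAt.tendsto.comp this
  have hR := tendsto_sum_gridPoint hle (hf.continuous.pow 2) (continuous_const (y := (1 : ℝ)))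
    (x := fun n i => gridPoint t T n i)
    fun n i => ⟨le_rfl, gridPoint_mono hle n (Nat.le_succ i)⟩
  simp only [mul_one, Pi.pow_apply] at hR
  simp only [hsum] at hlim1
  refine tendsto_nhds_unique hlim1 (Tendsto.const_mul _ ?_)
  exact (Complex.continuous_exp.comp Complex.continuous_ofReal).continuousAt.tendsto.comp
    (hR.neg.div_const 2)

/-- Wiener integrals over `[t, T]` are jointly Gaussian and independent of the past up to `t`. -/
theorem IsFiltrationBrownian.isIndepGaussianPair [IsProbabilityMeasure P]
    (hW : IsFiltrationBrownian P 𝓕 W) {t T : ℝ≥0} (htT : t ≤ T) {f g : ℝ → ℝ}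
    (hf : ContDiff ℝ 1 f) (hg : ContDiff ℝ 1 g) :
    IsIndepGaussianPair P (𝓕 t) (wienerIntegral W t T f) (wienerIntegral W t T g)
      (∫ s in (t : ℝ)..T, f s ^ 2) (∫ s in (t : ℝ)..T, f s * g s)
      (∫ s in (t : ℝ)..T, g s ^ 2) where
  aemeasurable_fst := hW.aemeasurable_wienerIntegral htT hf
  aemeasurable_snd := hW.aemeasurable_wienerIntegral htT hg
  setIntegral_cexp A hA a b := by
    have hA' : MeasurableSet A := 𝓕.le _ _ hA
    have h := hW.setIntegral_cexp_wienerIntegral htT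
      ((contDiff_const (c := a)).mul hf |>.add ((contDiff_const (c := b)).mul hg)) hA
    have hi : ∀ k : ℝ → ℝ, Continuous k → IntervalIntegrable k volume (t : ℝ) T :=
      fun k hk => hk.intervalIntegrable _ _
    have hfc := hf.continuous
    have hgc := hg.continuous
    have hvar : ∫ s in (t : ℝ)..T, (a * f s + b * g s) ^ 2
        = a ^ 2 * (∫ s in (t : ℝ)..T, f s ^ 2) + 2 * a * b * (∫ s in (t : ℝ)..T, f s * g s)
          + b ^ 2 * ∫ s in (t : ℝ)..T, g s ^ 2 := by
      rw [← intervalIntegral.integral_const_mul, ← intervalIntegral.integral_const_mul,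
        ← intervalIntegral.integral_const_mul,
        ← intervalIntegral.integral_add (hi _ (by fun_prop)) (hi _ (by fun_prop)),
        ← intervalIntegral.integral_add (hi _ (by fun_prop)) (hi _ (by fun_prop))]
      exact intervalIntegral.integral_congr fun s _ => by ring
    rw [← hvar, ← h]
    refine integral_congr_ae ?_
    filter_upwards [ae_restrict_of_ae hW.brownian.cont] with ω hω
    rw [← wienerIntegral_linear t T hf hg a b hω]

end WienerIntegral

/-! ### Bond and call prices in the Vasicek model -/

section Vasicek

/-- The solution `G(t; T) = (1 - exp (-κ τ)) / κ` of the Riccati equation of the Vasicek model, as a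
function of the time to maturity `τ = T - t`. -/
def vasicekG (κ τ : ℝ) : ℝ := (1 - Real.exp (-κ * τ)) / κ

lemma vasicekG_zero (κ : ℝ) : vasicekG κ 0 = 0 := by simp [vasicekG]

lemma contDiff_vasicekG (κ T : ℝ) {n : WithTop ℕ∞} :
    ContDiff ℝ n fun s => vasicekG κ (T - s) := by
  unfold vasicekG; fun_prop

lemma hasDerivAt_exp_vasicek (κ T s : ℝ) :
    HasDerivAt (fun s => Real.exp (-κ * (T - s))) (κ * Real.exp (-κ * (T - s))) s :=
  ((((hasDerivAt_id s).const_sub T).const_mul (-κ)).exp).congr_deriv (by simp; ring)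

lemma hasDerivAt_vasicekG {κ : ℝ} (hκ : κ ≠ 0) (T s : ℝ) :
    HasDerivAt (fun s => vasicekG κ (T - s)) (-Real.exp (-κ * (T - s))) s :=
  (((hasDerivAt_exp_vasicek κ T s).const_sub 1).div_const κ).congr_deriv (by field_simp)

/-- The volatility of the log forward bond price is a multiple of `exp (-κ (T - t))`. -/
lemma vasicekG_sub {κ : ℝ} (hκ : κ ≠ 0) (T Tb s : ℝ) :
    vasicekG κ (T - s) - vasicekG κ (Tb - s)
      = -vasicekG κ (Tb - T) * (1 - κ * vasicekG κ (T - s)) := by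
  have : Real.exp (-κ * (Tb - s)) = Real.exp (-κ * (Tb - T)) * Real.exp (-κ * (T - s)) := by
    rw [← Real.exp_add]; ring_nf
  simp only [vasicekG, this]
  field_simp
  ring

/-- Total variance over `[t, T]` of the log forward price of the bond with maturity `Tb`. -/
def totalVar (κ δ T Tb t : ℝ) : ℝ :=
  δ ^ 2 * (Real.exp (-κ * T) - Real.exp (-κ * Tb)) ^ 2
    * (Real.exp (2 * κ * T) - Real.exp (2 * κ * t)) / (2 * κ ^ 3)

lemma totalVar_self (κ δ T Tb : ℝ) : totalVar κ δ T Tb T = 0 := by simp [totalVar]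

lemma totalVar_pos {κ δ T Tb t : ℝ} (hκ : 0 < κ) (hδ : 0 < δ) (htT : t < T) (hTb : T < Tb) :
    0 < totalVar κ δ T Tb t := by
  have h1 : 0 < Real.exp (-κ * T) - Real.exp (-κ * Tb) :=
    sub_pos.2 (Real.exp_lt_exp.2 (by nlinarith))
  have h2 : 0 < Real.exp (2 * κ * T) - Real.exp (2 * κ * t) :=
    sub_pos.2 (Real.exp_lt_exp.2 (by nlinarith))
  unfold totalVar
  positivity

lemma hasDerivAt_totalVar {κ : ℝ} (hκ : κ ≠ 0) (δ T Tb t : ℝ) :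
    HasDerivAt (totalVar κ δ T Tb)
      (-(δ ^ 2 * (vasicekG κ (T - t) - vasicekG κ (Tb - t)) ^ 2)) t := by
  have h1 : HasDerivAt (fun t => Real.exp (2 * κ * t)) (Real.exp (2 * κ * t) * (2 * κ)) t := by
    simpa using ((hasDerivAt_id t).const_mul (2 * κ)).exp
  have h := ((h1.const_sub (Real.exp (2 * κ * T))).const_mul
    (δ ^ 2 * (Real.exp (-κ * T) - Real.exp (-κ * Tb)) ^ 2)).div_const (2 * κ ^ 3)
  refine h.congr_deriv ?_
  have e : ∀ u, Real.exp (-κ * (u - t)) = Real.exp (-κ * u) * Real.exp (κ * t) := by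
    intro u; rw [← Real.exp_add]; ring_nf
  have e2 : Real.exp (2 * κ * t) = Real.exp (κ * t) ^ 2 := by
    rw [← Real.exp_nat_mul]; push_cast; ring_nf
  simp only [vasicekG, e, e2]
  field_simp
  ring

lemma integral_eq_totalVar {κ : ℝ} (hκ : κ ≠ 0) (δ T Tb t : ℝ) :
    ∫ s in t..T, δ ^ 2 * (vasicekG κ (T - s) - vasicekG κ (Tb - s)) ^ 2
      = totalVar κ δ T Tb t := by
  have hc : Continuous fun s => δ ^ 2 * (vasicekG κ (T - s) - vasicekG κ (Tb - s)) ^ 2 :=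
    continuous_const.mul ((((contDiff_vasicekG κ T (n := 0)).continuous).sub
      ((contDiff_vasicekG κ Tb (n := 0)).continuous)).pow 2)
  have h := intervalIntegral.integral_eq_sub_of_hasDerivAt
    (fun s _ => hasDerivAt_totalVar hκ δ T Tb s) (hc.neg.intervalIntegrable t T)
  rw [intervalIntegral.integral_neg, totalVar_self] at h
  linarith

/-- Explicit solution of the integrated Ornstein–Uhlenbeck equation along one path. -/
lemma integral_ornsteinUhlenbeck {κ θ δ : ℝ} (hκ : κ ≠ 0) {y w : ℝ → ℝ} (hy : Continuous y)
    (hw : Continuous w) {t T : ℝ} (htT : t ≤ T)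
    (h : ∀ s ∈ Icc t T, y s = y t + κ * θ * (s - t) - κ * (∫ r in t..s, y r) + δ * (w s - w t)) :
    ∫ s in t..T, y s = vasicekG κ (T - t) * y t + θ * (T - t - vasicekG κ (T - t))
      - δ * ∫ s in t..T, (w s - w t) * deriv (fun s => vasicekG κ (T - s)) s := by
  have hu : ∀ s, HasDerivAt (fun s => ∫ r in t..s, y r) (y s) s := fun s =>
    (hy.integral_hasStrictDerivAt t s).hasDerivAt
  have hE : Continuous fun s => Real.exp (-κ * (T - s)) := by fun_prop
  -- the bracket is chosen so that its product with the integrating factor is driven by `w` alone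
  have hd : ∀ s ∈ uIcc t T, HasDerivAt (fun s => Real.exp (-κ * (T - s))
      * ((∫ r in t..s, y r) - y t / κ - θ * (s - t) + θ / κ))
      (Real.exp (-κ * (T - s)) * (δ * (w s - w t))) s := by
    intro s hs
    rw [uIcc_of_le htT] at hs
    have h1 := (hasDerivAt_exp_vasicek κ T s).mul
      ((((hu s).sub_const (y t / κ)).sub (((hasDerivAt_id s).sub_const t).const_mul θ)).add_const
        (θ / κ))
    refine h1.congr_deriv ?_
    simp only [Pi.sub_apply, id]
    rw [h s hs]
    field_simp
    ring
  have hI := intervalIntegral.integral_eq_sub_of_hasDerivAt hd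
    ((hE.mul (continuous_const.mul (hw.sub continuous_const))).intervalIntegrable _ _)
  have hJ : ∫ s in t..T, (w s - w t) * deriv (fun s => vasicekG κ (T - s)) s
      = -∫ s in t..T, (w s - w t) * Real.exp (-κ * (T - s)) := by
    rw [← intervalIntegral.integral_neg]
    refine intervalIntegral.integral_congr fun s _ => ?_
    simp only [(hasDerivAt_vasicekG hκ T s).deriv]; ring
  have hK : ∫ s in t..T, Real.exp (-κ * (T - s)) * (δ * (w s - w t))
      = δ * ∫ s in t..T, (w s - w t) * Real.exp (-κ * (T - s)) := by
    rw [← intervalIntegral.integral_const_mul]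
    exact intervalIntegral.integral_congr fun s _ => by ring
  rw [hK] at hI
  simp only [sub_self, mul_zero, Real.exp_zero, one_mul, intervalIntegral.integral_same] at hI
  rw [hJ, mul_neg, hI]
  simp only [vasicekG]
  field_simp
  ring

variable {Ω : Type*} {mΩ : MeasurableSpace Ω} {P : Measure Ω}
  {𝓕 : Filtration ℝ≥0 mΩ} {W Y : ℝ≥0 → Ω → ℝ} {κ θ δ : ℝ}

/-- The integrated short rate over `[0, t]` expressed through the current values of `Y` and `W`.
Unlike the path integral, this is `𝓕 t`-measurable without completing the filtration. -/
def integratedRate (κ θ δ : ℝ) (W Y : ℝ≥0 → Ω → ℝ) (t : ℝ≥0) (ω : Ω) : ℝ :=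
  (κ * θ * t + δ * (W t ω - W 0 ω) - (Y t ω - Y 0 ω)) / κ

lemma measurable_integratedRate (hW : IsFiltrationBrownian P 𝓕 W)
    (hY : IsVasicekProcess P 𝓕 κ θ δ W Y) (t : ℝ≥0) :
    Measurable[𝓕 t] (integratedRate κ θ δ W Y t) := by
  have h1 := hW.measurable (le_refl t)
  have h2 := hW.measurable (zero_le : 0 ≤ t)
  have h3 : Measurable[𝓕 t] (Y t) := hY.adapted t
  have h4 : Measurable[𝓕 t] (Y 0) := (hY.adapted 0).mono (𝓕.mono (zero_le : 0 ≤ t)) le_rfl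
  exact (((h1.sub h2).const_mul δ).const_add (κ * θ * t) |>.sub (h3.sub h4)).div_const κ

/-- Almost sure explicit solution: the money market account at times `t` and `T` and the factor at
time `T`, in terms of `𝓕 t`-measurable variables, the Brownian increment over `[t, T]` and one
Wiener integral over `[t, T]`. -/
lemma ae_vasicek_explicit (hκ : κ ≠ 0) (hW : IsFiltrationBrownian P 𝓕 W)
    (hY : IsVasicekProcess P 𝓕 κ θ δ W Y) {t T : ℝ≥0} (htT : t ≤ T) :
    ∀ᵐ ω ∂P,
      moneyMarket (vasicek κ θ δ) Y t ω = Real.exp (integratedRate κ θ δ W Y t ω) ∧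
      moneyMarket (vasicek κ θ δ) Y T ω = Real.exp (integratedRate κ θ δ W Y t ω
        + (vasicekG κ (T - t) * Y t ω + θ * (T - t - vasicekG κ (T - t))
          + δ * wienerIntegral W t T (fun s => vasicekG κ (T - s)) ω)) ∧
      Y T ω = θ + (Y t ω - θ) * (1 - κ * vasicekG κ (T - t))
        + δ * (W T ω - W t ω - κ * wienerIntegral W t T (fun s => vasicekG κ (T - s)) ω) := by
  filter_upwards [hY.cont, hY.sde, hW.brownian.cont] with ω hyc hsde hwc
  have hy : Continuous fun s : ℝ => Y s.toNNReal ω := hyc.comp continuous_real_toNNReal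
  have hw : Continuous fun s : ℝ => W s.toNNReal ω := hwc.comp continuous_real_toNNReal
  have hle : (t : ℝ) ≤ T := htT
  have hdrift : ∀ a b : ℝ, ∫ s in a..b, κ * (θ - Y s.toNNReal ω)
      = κ * θ * (b - a) - κ * ∫ s in a..b, Y s.toNNReal ω := by
    intro a b
    rw [intervalIntegral.integral_const_mul, intervalIntegral.integral_sub
      (continuous_const.intervalIntegrable _ _) (hy.intervalIntegrable _ _),
      intervalIntegral.integral_const, smul_eq_mul]
    ring
  have hint : ∀ u : ℝ≥0, ∫ s in (0 : ℝ)..u, Y s.toNNReal ω = integratedRate κ θ δ W Y u ω := by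
    intro u
    have h := hsde u
    rw [hdrift] at h
    rw [integratedRate, h]
    field_simp
    ring
  have hM : ∀ u : ℝ≥0, moneyMarket (vasicek κ θ δ) Y u ω
      = Real.exp (∫ s in (0 : ℝ)..u, Y s.toNNReal ω) := fun u => rfl
  have hsplit : ∀ u : ℝ, ∫ s in (0 : ℝ)..u, Y s.toNNReal ω
      = (∫ s in (0 : ℝ)..t, Y s.toNNReal ω) + ∫ s in (t : ℝ)..u, Y s.toNNReal ω := fun u =>
    (intervalIntegral.integral_add_adjacent_intervals (hy.intervalIntegrable _ _)
      (hy.intervalIntegrable _ _)).symm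
  have hinc : ∀ s : ℝ, (t : ℝ) ≤ s → Y s.toNNReal ω = Y t ω + κ * θ * (s - t)
      - κ * (∫ r in (t : ℝ)..s, Y r.toNNReal ω) + δ * (W s.toNNReal ω - W t ω) := by
    intro s hs
    have h1 := hsde s.toNNReal
    have h2 := hsde t
    rw [hdrift, Real.coe_toNNReal _ (t.2.trans hs), hsplit] at h1
    rw [hdrift] at h2
    linarith
  have hou := integral_ornsteinUhlenbeck (θ := θ) (δ := δ) hκ hy hw hle
    (by simpa only [Real.toNNReal_coe] using fun s hs => hinc s hs.1)
  simp only [Real.toNNReal_coe] at hou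
  have hwi : wienerIntegral W t T (fun s => vasicekG κ (T - s)) ω
      = -∫ s in (t : ℝ)..T, (W s.toNNReal ω - W t ω)
        * deriv (fun s => vasicekG κ (T - s)) s := by
    rw [wienerIntegral, sub_self, vasicekG_zero, zero_mul, zero_sub]
  have hinc' := hinc T hle
  rw [Real.toNNReal_coe] at hinc'
  refine ⟨by rw [hM, hint], ?_, ?_⟩
  · rw [hM, hsplit, hint, hou, hwi, mul_neg, ← sub_eq_add_neg]
  · rw [hinc', hou, hwi]
    ring

variable [IsProbabilityMeasure P]

/-- Logarithm of the zero-coupon bond price with maturity `T` at time `t`, when the factor is `y`. -/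
def bondLog (κ θ δ T t y : ℝ) : ℝ :=
  -vasicekG κ (T - t) * y - θ * (T - t - vasicekG κ (T - t))
    + δ ^ 2 / 2 * ∫ s in t..T, vasicekG κ (T - s) ^ 2

lemma wienerIntegral_const_mul (t T : ℝ≥0) {f : ℝ → ℝ} (hf : ContDiff ℝ 1 f) (a : ℝ) {ω : Ω}
    (hω : Continuous fun s => W s ω) :
    wienerIntegral W t T (fun s => a * f s) ω = a * wienerIntegral W t T f ω := by
  simpa using wienerIntegral_linear t T hf hf a 0 hω

/-- Conditional expectation of a discounted claim whose payoff is a function of an `𝓕 t`-measurable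
part and of a Wiener integral over `[t, T]`. -/
lemma condExp_div_moneyMarket (hκ : κ ≠ 0) (hW : IsFiltrationBrownian P 𝓕 W)
    (hY : IsVasicekProcess P 𝓕 κ θ δ W Y) {t T : ℝ≥0} (htT : t ≤ T) {g f : ℝ → ℝ} {X H : Ω → ℝ}
    (hg : ContDiff ℝ 1 g) (hf : Measurable f) (hX : Measurable[𝓕 t] X)
    (hH : H =ᵐ[P] fun ω => f (X ω + wienerIntegral W t T g ω))
    (hint : Integrable (fun ω => H ω / moneyMarket (vasicek κ θ δ) Y T ω) P) :
    claimPrice P 𝓕 (vasicek κ θ δ) Y T H t =ᵐ[P]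
      fun ω => Real.exp (bondLog κ θ δ T t (Y t ω))
        * ∫ z, f (X ω - δ * (∫ s in (t : ℝ)..T, vasicekG κ (T - s) * g s)
          + √(∫ s in (t : ℝ)..T, g s ^ 2) * z) ∂gaussianReal 0 1 := by
  have hG : ContDiff ℝ 1 fun s => vasicekG κ ((T : ℝ) - s) := contDiff_vasicekG κ T
  have hpair := hW.isIndepGaussianPair htT (contDiff_const (c := -δ) |>.mul hG) hg
  set K : Ω → ℝ := fun ω => Real.exp (-(integratedRate κ θ δ W Y t ω
    + (vasicekG κ (T - t) * Y t ω + θ * (T - t - vasicekG κ (T - t))))) with hK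
  have hKm : Measurable[𝓕 t] K := by
    have h1 := measurable_integratedRate hW hY t
    have h2 : Measurable[𝓕 t] (Y t) := hY.adapted t
    exact Real.measurable_exp.comp (h1.add ((h2.const_mul _).add_const _)).neg
  have hexpl := ae_vasicek_explicit hκ hW hY htT
  have hdec : (fun ω => H ω / moneyMarket (vasicek κ θ δ) Y T ω) =ᵐ[P] fun ω =>
      K ω * (Real.exp (wienerIntegral W t T (fun s => -δ * vasicekG κ (T - s)) ω)
        * f (X ω + wienerIntegral W t T g ω)) := by
    filter_upwards [hexpl, hH, hW.brownian.cont] with ω h1 h2 hω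
    rw [h2, h1.2.1, wienerIntegral_const_mul t T hG _ hω, div_eq_mul_inv, ← Real.exp_neg, hK,
      ← mul_assoc, ← Real.exp_add, mul_comm]
    ring_nf
  have hce := hpair.condExp_eq (𝓕.le t) hKm hX hf (hint.congr hdec)
  filter_upwards [(condExp_congr_ae hdec).trans hce, hexpl] with ω h1 h2
  rw [claimPrice, h1, h2.1, hK, ← mul_assoc, ← mul_assoc, ← Real.exp_add, ← Real.exp_add]
  have e1 : ∫ s in (t : ℝ)..T, (-δ * vasicekG κ (T - s)) ^ 2
      = δ ^ 2 * ∫ s in (t : ℝ)..T, vasicekG κ (T - s) ^ 2 := by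
    rw [← intervalIntegral.integral_const_mul]
    exact intervalIntegral.integral_congr fun s _ => by ring
  have e2 : ∫ s in (t : ℝ)..T, -δ * vasicekG κ (T - s) * g s
      = -(δ * ∫ s in (t : ℝ)..T, vasicekG κ (T - s) * g s) := by
    rw [← neg_mul, ← intervalIntegral.integral_const_mul]
    exact intervalIntegral.integral_congr fun s _ => by ring
  congr 2
  · rw [e1, bondLog]; ring
  · rw [e2]; rfl

lemma moneyMarket_pos (A : AffineModel) (t : ℝ≥0) (ω : Ω) : 0 < moneyMarket A Y t ω :=
  Real.exp_pos _

lemma bondPrice_ae_eq (hκ : κ ≠ 0) (hW : IsFiltrationBrownian P 𝓕 W)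
    (hY : IsVasicekProcess P 𝓕 κ θ δ W Y)
    (hM : ∀ T : ℝ≥0, Integrable (fun ω => 1 / moneyMarket (vasicek κ θ δ) Y T ω) P)
    {t T : ℝ≥0} (htT : t ≤ T) :
    bondPrice P 𝓕 (vasicek κ θ δ) Y T t =ᵐ[P]
      fun ω => Real.exp (bondLog κ θ δ T t (Y t ω)) := by
  have h := condExp_div_moneyMarket hκ hW hY htT (g := fun _ => 0) (f := fun _ => 1)
    (X := fun _ => 0) (H := fun _ => 1) contDiff_const measurable_const measurable_const
    (ae_of_all _ fun _ => rfl) (hM T)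
  simpa [bondPrice] using h

/-- Forward price of the call: the expectation under a lognormal law whose variance is the total
variance of the log forward bond price. -/
theorem callPrice_div_bondPrice_ae_eq (hκ : κ ≠ 0) (hW : IsFiltrationBrownian P 𝓕 W)
    (hY : IsVasicekProcess P 𝓕 κ θ δ W Y)
    (hM : ∀ T : ℝ≥0, Integrable (fun ω => 1 / moneyMarket (vasicek κ θ δ) Y T ω) P)
    {t T Tb : ℝ≥0} (htT : t ≤ T) (hTb : T ≤ Tb) (k : ℝ) :
    (fun ω => callPrice P 𝓕 (vasicek κ θ δ) Y T Tb k t ω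
        / bondPrice P 𝓕 (vasicek κ θ δ) Y T t ω)
      =ᵐ[P] fun ω => callValue k (totalVar κ δ T Tb t)
        (logForward P 𝓕 (vasicek κ θ δ) Y T Tb t ω) := by
  have hG : ContDiff ℝ 1 fun s => vasicekG κ ((T : ℝ) - s) := contDiff_vasicekG κ T
  have hGb : ContDiff ℝ 1 fun s => vasicekG κ ((Tb : ℝ) - s) := contDiff_vasicekG κ Tb
  have hB := bondPrice_ae_eq hκ hW hY hM hTb
  set g : ℝ → ℝ := fun s => δ * (vasicekG κ (T - s) - vasicekG κ (Tb - s)) with hg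
  have hgc : ContDiff ℝ 1 g := contDiff_const.mul (hG.sub hGb)
  -- `log B^Tb_T = X + ∫ g dW`, where `X` is known at time `t`
  set X : Ω → ℝ := fun ω => bondLog κ θ δ Tb T
    (θ + (Y t ω - θ) * (1 - κ * vasicekG κ (T - t))) with hXdef
  have hX : Measurable[𝓕 t] X := by
    have h2 : Measurable[𝓕 t] (Y t) := hY.adapted t
    simp only [hXdef, bondLog]
    exact ((((h2.sub_const θ).mul_const _).const_add θ).const_mul _ |>.sub_const _).add_const _
  have hH : (fun ω => callPayoff k (Real.log (bondPrice P 𝓕 (vasicek κ θ δ) Y Tb T ω))) =ᵐ[P]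
      fun ω => callPayoff k (X ω + wienerIntegral W t T g ω) := by
    filter_upwards [hB, ae_vasicek_explicit hκ hW hY htT, hW.brownian.cont] with ω h1 h2 hω
    have hgeq : g = fun s => -δ * vasicekG κ (Tb - T) * 1
        + δ * κ * vasicekG κ (Tb - T) * vasicekG κ (T - s) := by
      funext s
      simp only [hg, vasicekG_sub hκ]; ring
    have hlin := wienerIntegral_linear t T (contDiff_const (c := (1 : ℝ))) hG
      (-δ * vasicekG κ (Tb - T)) (δ * κ * vasicekG κ (Tb - T)) hω
    have hone : wienerIntegral W t T (fun _ => 1) ω = W T ω - W t ω := by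
      simp [wienerIntegral]
    rw [h1, Real.log_exp, h2.2.2, hgeq, hlin, hone]
    simp only [hXdef, bondLog]
    ring_nf
  have hint : Integrable (fun ω => callPayoff k
      (Real.log (bondPrice P 𝓕 (vasicek κ θ δ) Y Tb T ω)) / moneyMarket (vasicek κ θ δ) Y T ω) P := by
    -- the discounted payoff is at most the discounted bond, a conditional expectation
    refine (integrable_condExp (m := 𝓕 T)
      (f := fun ω => 1 / moneyMarket (vasicek κ θ δ) Y Tb ω) (μ := P)).mono' ?_ ?_
    · have h1 : AEMeasurable (fun ω => callPayoff k (X ω + wienerIntegral W t T g ω)) P :=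
        (continuous_callPayoff k).measurable.comp_aemeasurable
          ((hX.mono (𝓕.le t) le_rfl).aemeasurable.add (hW.aemeasurable_wienerIntegral htT hgc))
      have h2 := (h1.congr hH.symm).mul (hM T).aemeasurable
      refine (h2.congr (ae_of_all _ fun ω => ?_)).aestronglyMeasurable
      simp only [Pi.mul_apply, mul_one_div]
    · filter_upwards [hB] with ω h1
      have hm := moneyMarket_pos (Y := Y) (vasicek κ θ δ) T ω
      rw [Real.norm_eq_abs, abs_of_nonneg (div_nonneg (callPayoff_nonneg _ _) hm.le),
        div_le_iff₀ hm]
      refine (callPayoff_le_exp _ _).trans ?_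
      rw [Real.exp_log (by rw [h1]; exact Real.exp_pos _), bondPrice, claimPrice, mul_comm]
  have hcall := condExp_div_moneyMarket hκ hW hY htT hgc (continuous_callPayoff k).measurable hX
    hH hint
  filter_upwards [hcall, bondPrice_ae_eq hκ hW hY hM htT,
    bondPrice_ae_eq hκ hW hY hM (htT.trans hTb)] with ω h1 h2 h3
  have hvar : ∫ s in (t : ℝ)..T, g s ^ 2 = totalVar κ δ T Tb t := by
    rw [← integral_eq_totalVar hκ]
    exact intervalIntegral.integral_congr fun s _ => by simp only [hg]; ring
  have hmean : X ω - δ * (∫ s in (t : ℝ)..T, vasicekG κ (T - s) * g s)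
      = bondLog κ θ δ Tb t (Y t ω) - bondLog κ θ δ T t (Y t ω) - totalVar κ δ T Tb t / 2 := by
    have hi : ∀ φ : ℝ → ℝ, Continuous φ → ∀ a b, IntervalIntegrable φ volume a b :=
      fun φ hφ a b => hφ.intervalIntegrable a b
    have hGc := hG.continuous
    have hGbc := hGb.continuous
    have hsplit := intervalIntegral.integral_add_adjacent_intervals
      (hi (fun s => vasicekG κ (Tb - s) ^ 2) (by fun_prop) t T)
      (hi (fun s => vasicekG κ (Tb - s) ^ 2) (by fun_prop) T Tb)
    have hcov : δ * (∫ s in (t : ℝ)..T, vasicekG κ (T - s) * g s)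
        = δ ^ 2 / 2 * (∫ s in (t : ℝ)..T, vasicekG κ (T - s) ^ 2)
          - δ ^ 2 / 2 * (∫ s in (t : ℝ)..T, vasicekG κ (Tb - s) ^ 2)
          + totalVar κ δ T Tb t / 2 := by
      rw [← integral_eq_totalVar hκ, ← intervalIntegral.integral_const_mul,
        ← intervalIntegral.integral_const_mul, ← intervalIntegral.integral_const_mul,
        ← intervalIntegral.integral_div,
        ← intervalIntegral.integral_sub (hi _ (by fun_prop) _ _) (hi _ (by fun_prop) _ _),
        ← intervalIntegral.integral_add (hi _ (by fun_prop) _ _) (hi _ (by fun_prop) _ _)]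
      exact intervalIntegral.integral_congr fun s _ => by simp only [hg]; ring
    have hG1 := vasicekG_sub hκ T Tb t
    rw [hcov]
    simp only [hXdef, bondLog]
    rw [← hsplit]
    linear_combination (θ - Y t ω) * hG1
  rw [callPrice, h1, logForward, h2, h3, ← Real.exp_sub, Real.log_exp, callValue, hvar, hmean,
    mul_div_cancel_left₀ _ (Real.exp_pos _).ne']

end Vasicek

/-! ### Implied volatility -/

section ImpliedVolatility

/-- The Riccati solution `G` of the Vasicek model is unique and explicit. -/
lemma IsRiccatiSolution.eq_vasicekG {κ θ δ T : ℝ} (hκ : κ ≠ 0) {F G : ℝ → ℝ}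
    (h : IsRiccatiSolution (vasicek κ θ δ) T 0 F G) {t : ℝ} (ht : t ∈ Icc 0 T) :
    G t = vasicekG κ (T - t) := by
  -- `exp (κ (T - s)) (G s - 1 / κ)` is constant
  have hd : ∀ s ∈ Icc 0 T, HasDerivWithinAt
      (fun s => (G s - 1 / κ) * Real.exp (κ * (T - s))) 0 (Icc 0 T) s := by
    intro s hs
    have h1 := h.G_ode s hs
    have h2 : HasDerivAt (fun s => Real.exp (κ * (T - s))) (-κ * Real.exp (κ * (T - s))) s :=
      ((((hasDerivAt_id s).const_sub T).const_mul κ).exp).congr_deriv (by simp; ring)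
    refine ((h1.sub_const (1 / κ)).mul h2.hasDerivWithinAt).congr_deriv ?_
    simp only [vasicek]
    field_simp
    ring
  have hT : T ∈ Icc 0 T := ⟨ht.1.trans ht.2, le_rfl⟩
  have hconst := (convex_Icc 0 T).norm_image_sub_le_of_norm_hasDerivWithin_le (C := 0) hd
    (fun _ _ => by simp) ht hT
  rw [zero_mul, norm_le_zero_iff, sub_eq_zero, h.G_terminal] at hconst
  simp only [sub_self, mul_zero, Real.exp_zero, mul_one, neg_zero, zero_sub] at hconst
  have hexp : Real.exp (κ * (T - t)) * Real.exp (-κ * (T - t)) = 1 := by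
    rw [← Real.exp_add]; simp
  rw [vasicekG, eq_div_iff hκ]
  field_simp at hconst
  linear_combination (-Real.exp (-κ * (T - t))) * hconst - (κ * G t - 1) * hexp

lemma genCoeff_eq {κ θ δ : ℝ} (hκ : κ ≠ 0) {F G : ℝ → ℝ → ℝ}
    (hFG : ∀ T : ℝ, 0 ≤ T → IsRiccatiSolution (vasicek κ θ δ) T 0 (F T) (G T)) {T Tb t : ℝ}
    (hTb : T < Tb) (ht : t ∈ Icc 0 T) (x : ℝ) :
    genCoeff (vasicek κ θ δ) F G T Tb t x
      = 1 / 2 * δ ^ 2 * (vasicekG κ (T - t) - vasicekG κ (Tb - t)) ^ 2 := by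
  have h0 : 0 ≤ T := ht.1.trans ht.2
  rw [genCoeff, (hFG T h0).eq_vasicekG hκ ht,
    (hFG Tb (h0.trans hTb.le)).eq_vasicekG hκ ⟨ht.1, ht.2.trans hTb.le⟩]
  rfl

lemma solvesBackward_callValue {κ θ δ : ℝ} (hκ : 0 < κ) (hδ : 0 < δ) {F G : ℝ → ℝ → ℝ}
    (hFG : ∀ T : ℝ, 0 ≤ T → IsRiccatiSolution (vasicek κ θ δ) T 0 (F T) (G T)) {T Tb : ℝ}
    (hTb : T < Tb) (k : ℝ) :
    SolvesBackward (genCoeff (vasicek κ θ δ) F G T Tb) T (callPayoff k)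
      (fun t x => callValue k (totalVar κ δ T Tb t) x) := by
  refine ⟨fun x => by simp only [totalVar_self, callValue_zero], fun t ht => ?_⟩
  have hpos : ∀ s, s < T → 0 < totalVar κ δ T Tb s := fun s hs => totalVar_pos hκ hδ hs hTb
  have hw := hpos t ht.2
  have hfun : callValue k (totalVar κ δ T Tb t) = bsPrice k (totalVar κ δ T Tb t) :=
    funext fun x => callValue_eq_bsPrice hw k x
  refine ⟨?_, fun x => ?_⟩
  · beta_reduce
    exact hfun ▸ contDiff_bsPrice k _
  have hd : HasDerivAt (fun s => callValue k (totalVar κ δ T Tb s) x) _ t :=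
    ((hasDerivAt_bsPrice_variance hw k x).comp t (hasDerivAt_totalVar hκ.ne' δ T Tb t))
      |>.congr_of_eventuallyEq (by
        filter_upwards [Iio_mem_nhds ht.2] with s hs using callValue_eq_bsPrice (hpos s hs) k x)
  refine ⟨hd.differentiableAt, ?_⟩
  rw [hd.deriv, generator]
  simp only [hfun]
  rw [(hasDerivAt_deriv_bsPrice hw k x).deriv, (hasDerivAt_bsPrice hw k x).deriv,
    genCoeff_eq hκ.ne' hFG hTb ⟨ht.1.le, ht.2.le⟩]
  have := (Real.sqrt_pos.2 hw).ne'
  field_simp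
  ring

/-- The implied volatility of the Vasicek model in closed form. -/
def vasicekVol (κ δ T Tb t : ℝ) : ℝ :=
  δ / κ ^ (3 / 2 : ℝ) * √((Real.exp (2 * κ * T) - Real.exp (2 * κ * t)) / (2 * (T - t)))
    * (Real.exp (-κ * T) - Real.exp (-κ * Tb))

lemma rpow_three_halves {κ : ℝ} (hκ : 0 < κ) : κ ^ (3 / 2 : ℝ) = κ * √κ := by
  rw [show (3 / 2 : ℝ) = 1 + 1 / 2 by norm_num, Real.rpow_add hκ, Real.rpow_one,
    Real.sqrt_eq_rpow]

lemma vasicekVol_pos {κ δ T Tb t : ℝ} (hκ : 0 < κ) (hδ : 0 < δ) (htT : t < T) (hTb : T < Tb) :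
    0 < vasicekVol κ δ T Tb t := by
  have h1 : 0 < Real.exp (-κ * T) - Real.exp (-κ * Tb) :=
    sub_pos.2 (Real.exp_lt_exp.2 (by nlinarith))
  have h2 : 0 < Real.exp (2 * κ * T) - Real.exp (2 * κ * t) :=
    sub_pos.2 (Real.exp_lt_exp.2 (by nlinarith))
  have h3 : 0 < T - t := sub_pos.2 htT
  have h4 : 0 < √((Real.exp (2 * κ * T) - Real.exp (2 * κ * t)) / (2 * (T - t))) :=
    Real.sqrt_pos.2 (by positivity)
  unfold vasicekVol
  positivity

lemma vasicekVol_sq_mul {κ δ T Tb t : ℝ} (hκ : 0 < κ) (htT : t < T) :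
    vasicekVol κ δ T Tb t ^ 2 * (T - t) = totalVar κ δ T Tb t := by
  have h2 : 0 < Real.exp (2 * κ * T) - Real.exp (2 * κ * t) :=
    sub_pos.2 (Real.exp_lt_exp.2 (by nlinarith))
  have h3 : 0 < T - t := sub_pos.2 htT
  rw [vasicekVol, rpow_three_halves hκ, mul_pow, mul_pow, div_pow, mul_pow, Real.sq_sqrt hκ.le,
    Real.sq_sqrt (by positivity), totalVar]
  field_simp

lemma vasicekVol_eq_sqrt {κ δ T Tb t : ℝ} (hκ : 0 < κ) (hδ : 0 < δ) (htT : t < T)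
    (hTb : T < Tb) : vasicekVol κ δ T Tb t = √(totalVar κ δ T Tb t / (T - t)) := by
  rw [← vasicekVol_sq_mul hκ htT, mul_div_cancel_right₀ _ (sub_pos.2 htT).ne',
    Real.sqrt_sq (vasicekVol_pos hκ hδ htT hTb).le]

/-- The difference quotient under the square root converges to a derivative. -/
lemma tendsto_sqrt_exp_quotient {κ : ℝ} (hκ : 0 < κ) (T : ℝ) :
    Tendsto (fun t => √((Real.exp (2 * κ * T) - Real.exp (2 * κ * t)) / (2 * (T - t)))) (𝓝[<] T)
      (𝓝 (√κ * Real.exp (κ * T))) := by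
  have h1 : HasDerivAt (fun t => Real.exp (2 * κ * t)) (Real.exp (2 * κ * T) * (2 * κ)) T := by
    simpa using ((hasDerivAt_id T).const_mul (2 * κ)).exp
  have h2 : Tendsto (fun t => slope (fun t => Real.exp (2 * κ * t)) T t / 2) (𝓝[<] T)
      (𝓝 (Real.exp (2 * κ * T) * (2 * κ) / 2)) :=
    ((hasDerivAt_iff_tendsto_slope.1 h1).mono_left
      (nhdsWithin_mono T fun t ht => ne_of_lt ht)).div_const 2
  have h3 : √(Real.exp (2 * κ * T) * (2 * κ) / 2) = √κ * Real.exp (κ * T) := by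
    rw [show Real.exp (2 * κ * T) * (2 * κ) / 2 = κ * Real.exp (κ * T) ^ 2 by
      rw [← Real.exp_nat_mul]; push_cast; ring_nf, Real.sqrt_mul hκ.le,
      Real.sqrt_sq (Real.exp_pos _).le]
  rw [← h3]
  refine ((Real.continuous_sqrt.tendsto _).comp h2).congr' ?_
  filter_upwards [self_mem_nhdsWithin] with t ht
  have h4 : T - t ≠ 0 := (sub_pos.2 ht).ne'
  have h5 : t - T ≠ 0 := (sub_neg.2 ht).ne
  simp only [Function.comp, slope_def_field]
  congr 1
  field_simp
  ring

lemma tendsto_exp_neg_mul_atTop {κ : ℝ} (hκ : 0 < κ) :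
    Tendsto (fun s => Real.exp (-κ * s)) atTop (𝓝 0) :=
  Real.tendsto_exp_atBot.comp (tendsto_id.const_mul_atTop_of_neg (neg_lt_zero.2 hκ))

lemma tendsto_vasicekVol_expiry {κ : ℝ} (hκ : 0 < κ) (δ T Tb : ℝ) :
    Tendsto (fun t => vasicekVol κ δ T Tb t) (𝓝[<] T)
      (𝓝 (δ / κ * (1 - Real.exp (-κ * (Tb - T))))) := by
  have h := ((tendsto_sqrt_exp_quotient hκ T).const_mul (δ / κ ^ (3 / 2 : ℝ))).mul_const
    (Real.exp (-κ * T) - Real.exp (-κ * Tb))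
  refine Eq.subst (motive := fun l => Tendsto _ _ (𝓝 l)) ?_ h
  have hs := Real.sqrt_pos.2 hκ
  have e1 : Real.exp (κ * T) * Real.exp (-(κ * T)) = 1 := by rw [← Real.exp_add]; simp
  have e2 : Real.exp (κ * T) * Real.exp (-κ * Tb) = Real.exp (-κ * (Tb - T)) := by
    rw [← Real.exp_add]; ring_nf
  rw [rpow_three_halves hκ, ← e2]
  field_simp
  linear_combination δ * e1

lemma tendsto_vasicekVol_bond_maturity {κ δ t Tb : ℝ} (ht : t < Tb) :
    Tendsto (fun T => vasicekVol κ δ T Tb t) (𝓝[<] Tb) (𝓝 0) := by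
  have hc : ContinuousAt (fun T => vasicekVol κ δ T Tb t) Tb := by
    unfold vasicekVol
    have : 2 * (Tb - t) ≠ 0 := mul_ne_zero two_ne_zero (sub_pos.2 ht).ne'
    fun_prop (disch := assumption)
  have h := hc.tendsto.mono_left (nhdsWithin_le_nhds (s := Iio Tb))
  simpa [vasicekVol] using h

lemma tendsto_vasicekVol_long_bond {κ : ℝ} (hκ : 0 < κ) (δ : ℝ) {T t : ℝ} (htT : t < T) :
    Tendsto (fun Tb => vasicekVol κ δ T Tb t) atTop
      (𝓝 (δ / κ ^ (3 / 2 : ℝ) * √((1 - Real.exp (-2 * κ * (T - t))) / (2 * (T - t))))) := by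
  have h := ((tendsto_exp_neg_mul_atTop hκ).const_sub (Real.exp (-κ * T))).const_mul
    (δ / κ ^ (3 / 2 : ℝ) * √((Real.exp (2 * κ * T) - Real.exp (2 * κ * t)) / (2 * (T - t))))
  refine Eq.subst (motive := fun l => Tendsto _ _ (𝓝 l)) ?_ h
  have h3 : 0 < T - t := sub_pos.2 htT
  have e : (1 - Real.exp (-2 * κ * (T - t))) / (2 * (T - t))
      = (Real.exp (2 * κ * T) - Real.exp (2 * κ * t)) / (2 * (T - t)) * Real.exp (-κ * T) ^ 2 := by
    have e1 : Real.exp (-κ * T) ^ 2 = Real.exp (-(2 * κ * T)) := by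
      rw [← Real.exp_nat_mul]; push_cast; ring_nf
    have e2 : Real.exp (2 * κ * T) * Real.exp (-(2 * κ * T)) = 1 := by
      rw [← Real.exp_add]; simp
    have e3 : Real.exp (2 * κ * t) * Real.exp (-(2 * κ * T)) = Real.exp (-2 * κ * (T - t)) := by
      rw [← Real.exp_add]; ring_nf
    rw [e1, div_mul_eq_mul_div, sub_mul, e2, e3]
  rw [eq_comm, e, Real.sqrt_mul' _ (sq_nonneg _), Real.sqrt_sq (Real.exp_pos _).le, sub_zero]
  ring

lemma tendsto_vasicekVol_expiry_long_bond {κ : ℝ} (hκ : 0 < κ) (δ T : ℝ) :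
    Tendsto (fun p : ℝ × ℝ => vasicekVol κ δ T p.2 p.1) (𝓝[<] T ×ˢ atTop) (𝓝 (δ / κ)) := by
  have h1 := ((tendsto_sqrt_exp_quotient hκ T).comp
    (tendsto_fst (f := 𝓝[<] T) (g := (atTop : Filter ℝ)))).const_mul (δ / κ ^ (3 / 2 : ℝ))
  have h2 := ((tendsto_exp_neg_mul_atTop hκ).comp
    (tendsto_snd (f := 𝓝[<] T) (g := (atTop : Filter ℝ)))).const_sub (Real.exp (-κ * T))
  have h := h1.mul h2
  refine Eq.subst (motive := fun l => Tendsto _ _ (𝓝 l)) ?_ h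
  have hs := Real.sqrt_pos.2 hκ
  have e1 : Real.exp (κ * T) * Real.exp (-(κ * T)) = 1 := by rw [← Real.exp_add]; simp
  rw [rpow_three_halves hκ, sub_zero]
  field_simp
  linear_combination δ * e1

end ImpliedVolatility

end BondOptions

end

theorem mainTheorem3 {Ω : Type*} {mΩ : MeasurableSpace Ω} (P : Measure Ω)
    [IsProbabilityMeasure P] (𝓕 : Filtration ℝ≥0 mΩ) (κ θ δ : ℝ) (hκ : 0 < κ) (hδ : 0 < δ)
    (W Y : ℝ≥0 → Ω → ℝ)
    (hW : BondOptions.IsFiltrationBrownian P 𝓕 W)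
    (hY : BondOptions.IsVasicekProcess P 𝓕 κ θ δ W Y)
    (hM : ∀ T : ℝ≥0,
      Integrable (fun ω => 1 / BondOptions.moneyMarket (BondOptions.vasicek κ θ δ) Y T ω) P)
    (F G : ℝ → ℝ → ℝ)
    (hFG : ∀ T : ℝ, 0 ≤ T →
      BondOptions.IsRiccatiSolution (BondOptions.vasicek κ θ δ) T 0 (F T) (G T)) :
    -- the generator coefficient is explicit and does not depend on `x`
    (∀ T Tb : ℝ, T < Tb → ∀ t ∈ Icc 0 T, ∀ x : ℝ,
      BondOptions.genCoeff (BondOptions.vasicek κ θ δ) F G T Tb t x =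
        1 / 2 * δ ^ 2 * ((1 - Real.exp (-κ * (T - t))) / κ
          - (1 - Real.exp (-κ * (Tb - t))) / κ) ^ 2) ∧
    -- forward call price `v T Tb k t x` and its implied volatility `S T Tb k t x`
    ∃ v S : ℝ → ℝ → ℝ → ℝ → ℝ → ℝ,
      (∀ T Tb : ℝ≥0, T < Tb → ∀ k : ℝ,
        BondOptions.IsForwardCallPrice P 𝓕 (BondOptions.vasicek κ θ δ) Y T Tb k (v T Tb k) ∧
        BondOptions.SolvesBackward
          (BondOptions.genCoeff (BondOptions.vasicek κ θ δ) F G T Tb) T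
          (BondOptions.callPayoff k) (v T Tb k)) ∧
      -- the zeroth order approximation is exact
      (∀ T Tb k t x : ℝ, 0 ≤ t → t < T → T < Tb →
        BondOptions.IsImpliedVol (T - t) x k (v T Tb k t x) (S T Tb k t x) ∧
        (∀ z : ℝ → ℝ, S T Tb k t x = BondOptions.zerothOrderVol
          (BondOptions.genCoeff (BondOptions.vasicek κ θ δ) F G T Tb) z t T) ∧
        S T Tb k t x = √(1 / (T - t) * ∫ s in t..T,
          δ ^ 2 * ((1 - Real.exp (-κ * (T - s))) / κ
            - (1 - Real.exp (-κ * (Tb - s))) / κ) ^ 2) ∧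
        S T Tb k t x = δ / κ ^ (3 / 2 : ℝ)
          * √((Real.exp (2 * κ * T) - Real.exp (2 * κ * t)) / (2 * (T - t)))
          * (Real.exp (-κ * T) - Real.exp (-κ * Tb))) ∧
      -- limits
      (∀ T Tb k x : ℝ, 0 < T → T < Tb →
        Tendsto (fun t => S T Tb k t x) (𝓝[<] T)
          (𝓝 (δ / κ * (1 - Real.exp (-κ * (Tb - T)))))) ∧
      (∀ Tb k t x : ℝ, 0 ≤ t → t < Tb →
        Tendsto (fun T => S T Tb k t x) (𝓝[<] Tb) (𝓝 0)) ∧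
      (∀ T k t x : ℝ, 0 ≤ t → t < T →
        Tendsto (fun Tb => S T Tb k t x) atTop
          (𝓝 (δ / κ ^ (3 / 2 : ℝ)
            * √((1 - Real.exp (-2 * κ * (T - t))) / (2 * (T - t)))))) ∧
      (∀ T k x : ℝ, 0 < T →
        Tendsto (fun p : ℝ × ℝ => S T p.2 k p.1 x) (𝓝[<] T ×ˢ atTop) (𝓝 (δ / κ))) := by
  have hκ0 := hκ.ne'
  refine ⟨fun T Tb hTb t ht x => BondOptions.genCoeff_eq hκ0 hFG hTb ht x,
    fun T Tb k t x => BondOptions.callValue k (BondOptions.totalVar κ δ T Tb t) x,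
    fun T Tb _ t _ => BondOptions.vasicekVol κ δ T Tb t, fun T Tb hTb k => ⟨⟨?_, ?_⟩, ?_⟩,
    fun T Tb k t x ht0 htT hTb => ?_,
    fun T Tb _ _ _ _ => BondOptions.tendsto_vasicekVol_expiry hκ δ T Tb,
    fun Tb _ t _ _ ht => BondOptions.tendsto_vasicekVol_bond_maturity ht,
    fun T _ t _ _ htT => BondOptions.tendsto_vasicekVol_long_bond hκ δ htT,
    fun T _ _ _ => BondOptions.tendsto_vasicekVol_expiry_long_bond hκ δ T⟩
  · have hw : Continuous fun p : ℝ × ℝ => BondOptions.totalVar κ δ T Tb p.1 := by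
      unfold BondOptions.totalVar; fun_prop
    exact ((BondOptions.continuous_callValue k).comp (hw.prodMk continuous_snd)).continuousOn
  · exact fun t ht => BondOptions.callPrice_div_bondPrice_ae_eq hκ0 hW hY hM ht hTb.le k
  · exact BondOptions.solvesBackward_callValue hκ hδ hFG (NNReal.coe_lt_coe.2 hTb) k
  have hτ : 0 < T - t := sub_pos.2 htT
  have hsqrt := BondOptions.vasicekVol_eq_sqrt hκ hδ htT hTb
  have hint := BondOptions.integral_eq_totalVar hκ0 δ T Tb t
  refine ⟨?_, fun z => ?_, ?_, rfl⟩ <;> beta_reduce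
  · rw [BondOptions.callValue_eq_bsPrice (BondOptions.totalVar_pos hκ hδ htT hTb)]
    exact BondOptions.isImpliedVol_of_eq_bsPrice hτ (BondOptions.vasicekVol_pos hκ hδ htT hTb)
      (BondOptions.vasicekVol_sq_mul hκ htT) x k
  · rw [hsqrt, BondOptions.zerothOrderVol, ← hint]
    congr 2
    refine intervalIntegral.integral_congr fun s hs => ?_
    rw [uIcc_of_le htT.le] at hs
    simp only [BondOptions.genCoeff_eq hκ0 hFG hTb ⟨ht0.trans hs.1, hs.2⟩]
    ring
  · rw [hsqrt, ← hint, one_div_mul_eq_div]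
    rfl
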